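/- **Setting.** A substrate is a finite directed graph $G_S=(V_S,E_S)$ with a finite set $\mathcal T$ of types, sets $V_S^\tau\subseteq V_S$ ($\tau\in\mathcal T$) of nodes that can host type $\tau$, and capacities $d_S(\rho)>0$ on the resources $R_S=R_S^V\cup E_S$, where $R^V_S=\{(\tau,u):\tau\in\mathcal T,\ u\in V_S^\tau\}$. There is a finite set $\mathcal R$ of requests. A request $r$ is a directed graph $G_r=(V_r,E_r)$ with profit $b_r>0$, node types $\tau_r:V_r\to\mathcal T$, demands $d_r(i)\ge 0$ and $d_r(i,j)\ge 0$, allowed substrate nodes $V_S^{r,i}\subseteq\{u\in V_S^{\tau_r(i)}: d_S(\tau_r(i),u)\ge d_r(i)\}$ and allowed substrate edges $E_S^{r,i,j}\subseteq\{e\in E_S: d_S(e)\ge d_r(i,j)\}$. Each $G_r$ is a cactus: it is nonempty, connected and loopless, and any two distinct cycles of its undirected interpretation (in which a pair of antiparallel edges is a cycle) share at most one node. A valid mapping $m$ of $r$ maps each $i\in V_r$ to a node in $V_S^{r,i}$ and each $(i,j)\in E_r$ to (the edge set of) a directed path, possibly empty, from the image of $i$ to the image of $j$ that uses only edges in $E_S^{r,i,j}$;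 $\mathcal M_r$ is the set of valid mappings. The allocation $A(m,\tau,u)$ is the sum of $d_r(i)$ over the nodes $i$ of type $\tau$ mapped to $u$, and $A(m,u,v)$ is the sum of $d_r(i,j)$ over the edges $(i,j)$ whose path uses $(u,v)$. A solution selects for each request a valid mapping or rejects it; its profit is the sum of $b_r$ over the embedded requests, its load on a resource is the sum of their allocations. It is feasible if no load exceeds the capacity; $B_{\mathrm{IP}}$ is the maximum profit of a feasible solution. A solution is $(\alpha,\beta,\gamma)$-approximate with respect to a profit $B$ if its profit is at least $\alpha B$, and its loads on all node resources and on all edges are at most $\beta$ times and $\gamma$ times the capacity, respectively. **Linear program.** Fix for each $r$ an acyclic reorientation of $G_r$ (some edges are reversed) in which all nodes can be reached from a root. In it each cycle $C$ of $G_r$ has a unique target $t_C$, at which both its edges end. For a subgraph $H$ of $G_r$, $\mathrm{MCF}(H)$ is the system in variables $x\in[0,1]$, $y^u_i\in[0,1]$, $z^{u,v}_{i,j}\in[0,1]$, $a^\rho\ge 0$ (for $i$ and $(i,j)$ in $H$, $u\in V_S$, $(u,v)\in E_S$, $\rho\in R_S$): $\sum_{u\in V_S^{r,i}}y_i^u=x$;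 $\ \sum_{u\notin V_S^{r,i}}y_i^u=0$; $\ \sum_{(u,v)\in E_S}z_{i,j}^{u,v}-\sum_{(v,u)\in E_S}z^{v,u}_{i,j}=y_i^u-y_j^u$; $\ z_{i,j}^{u,v}=0$ for $(u,v)\notin E_S^{r,i,j}$; $\ a^{\tau,u}=\sum_{i:\tau_r(i)=\tau}d_r(i)y_i^u$; $\ a^{u,v}=\sum_{(i,j)}d_r(i,j)z^{u,v}_{i,j}$. The novel LP for a set $\mathcal A$ of requests has, for each $r\in\mathcal A$, global variables $x_r\in[0,1]$, $y^u_{r,i}\in[0,1]$, $a_r^\rho\ge0$, a copy $[\mathcal F]$ of $\mathrm{MCF}$ for the spanning forest of the edges that lie on no cycle, and a copy $[C,w]$ of $\mathrm{MCF}$ for each cycle $C$ and each $w\in V_S^{r,t_C}$. They are linked by $x_r=\sum_{u\in V_S^{r,i}}y^u_{r,i}$; $\ y^u_{r,i}=y^u_{r,i}[\mathcal F]$ for $u\in V_S^{r,i}$; $\ y^u_{r,i}=\sum_{w}y^u_{r,i}[C,w]$ for $i\in C$, $u\in V_S^{r,i}$; $\ y^u_{r,t_C}[C,w]=0$ for $u\in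 V_S^{r,t_C}\setminus\{w\}$; $\ a_r^{\tau,u}=\sum_{i:\tau_r(i)=\tau}d_r(i)y^u_{r,i}$; $\ a_r^{u,v}=a_r^{u,v}[\mathcal F]+\sum_{C,w}a_r^{u,v}[C,w]$; and $\sum_{r\in\mathcal A}a_r^\rho\le d_S(\rho)$ for all $\rho\in R_S$. **Algorithm** (for at most $N\ge1$ rounding tries). (1) Remove each request $r$ for which the LP for $\{r\}$ alone, maximizing $x_r$, has a value less than $1$; let $\mathcal R'$ be the set of the remaining requests. (2) Compute an optimal solution of the LP for $\mathcal R'$ with objective $\max\sum_{r\in\mathcal R'}b_rx_r$; let $B_{\mathrm{LP}}$ be its value. (3) For each $r\in\mathcal R'$ compute a decomposition of the LP solution, i.e. weights $f_r(m)\ge0$ ($m\in\mathcal M_r$) with $\sum_m f_r(m)=x_r$ and $\sum_m f_r(m)A(m,\rho)\le a_r^\rho$ for all $\rho\in R_S$. (4) Rounding try: independently for all $r\in\mathcal R'$, select $m$ with probability $f_r(m)$ and reject $r$ with probability $1-x_r$; the removed requests are rejected. Repeat until the solution is $(1/3,\beta,\gamma)$-approximate with respect to $B_{\mathrm{LP}}$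 or $N$ tries have been made; return the last solution. **Factors.** For $r\in\mathcal R'$ let $d_{\max}(r,\tau,u)=\max(\{0\}\cup\{d_r(i):\tau_r(i)=\tau,\ u\in V_S^{r,i}\})$, $d_{\max}(r,u,v)=\max(\{0\}\cup\{d_r(i,j):(u,v)\in E_S^{r,i,j}\})$ and $A_{\max}(r,\rho)=\max_{m\in\mathcal M_r}A(m,\rho)$. Let $\varepsilon\ge0$ be minimal with $d_{\max}(r,\rho)/d_S(\rho)\le\varepsilon$ for all $\rho\in R_S$, $r\in\mathcal R'$; let $\Delta(\rho)=\sum_{r\in\mathcal R':\,d_{\max}(r,\rho)>0}(A_{\max}(r,\rho)/d_{\max}(r,\rho))^2$, $\Delta(X)=\max_{\rho\in X}\Delta(\rho)$, and $$\beta=1+\varepsilon\sqrt{2\,\Delta(R_S^V)\log(|V_S||\mathcal T|)},\qquad \gamma=1+\varepsilon\sqrt{2\,\Delta(E_S)\log|E_S|}$$ (an empty maximum is $0$; if $R_S^V$ or $E_S$ is empty, then $\beta=1$ or $\gamma=1$, respectively). **Theorem.** Assume $|V_S|\ge3$ and $|E_S|\ne1$, and that all requests are cactus graphs. Then every step of the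 algorithm can be carried out: acyclic reorientations exist, the linear programs have optimal solutions for every choice of reorientations, and every optimal solution of the LP for $\mathcal R'$ has a decomposition for each $r\in\mathcal R'$. For all choices of the reorientations, the optimal LP solution and the decompositions, each rounding try yields with probability at least $1/20$ a solution that is $(1/3,\beta,\gamma)$-approximate with respect to both $B_{\mathrm{LP}}$ and the optimal profit $B_{\mathrm{IP}}$. Consequently, with at most $N\ge1$ rounding tries the algorithm returns such a solution with probability at least $1-(19/20)^N$. -/

import Mathlib

open scoped NNReal ENNReal Classical

noncomputable section

namespace VNEP

/-! ### Substrate, requests, valid mappings -/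

/-- Names of resources: `Sum.inl (τ, u)` is the node resource of type `τ` at `u`,
`Sum.inr (u, v)` is the edge resource `(u, v)`. -/
abbrev Res (V T : Type*) := (T × V) ⊕ (V × V)

/-- A substrate network: a directed graph `(V, E)`, the nodes `host τ` that can host type `τ`,
and positive capacities of all node and edge resources. -/
structure Substrate (V T : Type*) where
  E : Finset (V × V)
  host : T → Finset V
  cap : Res V T → ℝ
  node_cap_pos : ∀ τ, ∀ u ∈ host τ, 0 < cap (Sum.inl (τ, u))
  edge_cap_pos : ∀ f ∈ E, 0 < cap (Sum.inr f)

variable {V T W R : Type*} [Fintype V] [Fintype T] [Fintype W] [Fintype R]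

/-- The node resources `{(τ, u) | u ∈ host τ}`. -/
def Substrate.nodeRes (S : Substrate V T) : Finset (Res V T) :=
  Finset.univ.filter fun x => ∃ τ, ∃ u ∈ S.host τ, x = Sum.inl (τ, u)

/-- The edge resources. -/
def Substrate.edgeRes (S : Substrate V T) : Finset (Res V T) :=
  Finset.univ.filter fun x => ∃ f ∈ S.E, x = Sum.inr f

/-- All resources. -/
def Substrate.resources (S : Substrate V T) : Finset (Res V T) :=
  S.nodeRes ∪ S.edgeRes

/-- A request with node set `W`: a directed graph `(W, E)`, a positive profit, node types,
allowed substrate nodes `loc` and edges `eloc`, and nonnegative demands. Virtual nodes and edges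
are only allowed on substrate nodes and edges of sufficient capacity. -/
structure Request (S : Substrate V T) (W : Type*) where
  E : Finset (W × W)
  profit : ℝ
  profit_pos : 0 < profit
  type : W → T
  loc : W → Finset V
  eloc : W × W → Finset (V × V)
  nodeDemand : W → ℝ
  edgeDemand : W × W → ℝ
  nodeDemand_nonneg : ∀ i, 0 ≤ nodeDemand i
  edgeDemand_nonneg : ∀ e ∈ E, 0 ≤ edgeDemand e
  loc_spec : ∀ i, ∀ u ∈ loc i,
    u ∈ S.host (type i) ∧ nodeDemand i ≤ S.cap (Sum.inl (type i, u))
  eloc_spec : ∀ e ∈ E, ∀ f ∈ eloc e, f ∈ S.E ∧ edgeDemand e ≤ S.cap (Sum.inr f)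

variable {S : Substrate V T}

/-- `P` is the edge set of a directed path from `u` to `v` (the empty path if `u = v`). -/
def IsEdgePath (u v : V) (P : Finset (V × V)) : Prop :=
  ∃ (n : ℕ) (p : Fin (n + 1) → V), Function.Injective p ∧ p 0 = u ∧ p (Fin.last n) = v ∧
    P = Finset.univ.image fun k : Fin n => (p k.castSucc, p k.succ)

/-- Valid mappings: each node goes to an allowed substrate node, each virtual edge `(i, j)` to a
path of allowed edges from the image of `i` to the image of `j`. -/
def IsValid (q : Request S W) (m : (W → V) × (q.E → Finset (V × V))) : Prop :=
  (∀ i, m.1 i ∈ q.loc i) ∧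
  ∀ e : q.E, IsEdgePath (m.1 e.1.1) (m.1 e.1.2) (m.2 e) ∧ m.2 e ⊆ q.eloc e.1

/-- The set of valid mappings of a request. -/
abbrev ValidMapping (q : Request S W) :=
  {m : (W → V) × (q.E → Finset (V × V)) // IsValid q m}

/-- The allocation `A(m, x)` of a valid mapping on a resource. -/
def alloc {q : Request S W} (m : ValidMapping q) : Res V T → ℝ
  | Sum.inl (τ, u) => ∑ i with q.type i = τ ∧ m.1.1 i = u, q.nodeDemand i
  | Sum.inr f => ∑ e : q.E with f ∈ m.1.2 e, q.edgeDemand e.1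

/-- The maximal allocation over all valid mappings (`0` if there are none). -/
def maxAlloc (q : Request S W) (x : Res V T) : ℝ :=
  ⨆ m : ValidMapping q, alloc m x

/-- The maximal demand that a request may impose on a resource. -/
def maxDemand (q : Request S W) : Res V T → ℝ
  | Sum.inl (τ, u) => sSup (insert 0 {d | ∃ i, q.type i = τ ∧ u ∈ q.loc i ∧ d = q.nodeDemand i})
  | Sum.inr f => sSup (insert 0 {d | ∃ e ∈ q.E, f ∈ q.eloc e ∧ d = q.edgeDemand e})

/-! ### Cactus graphs and acyclic reorientations -/

/-- The endpoints of the edges in `C`. -/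
def verts (C : Finset (W × W)) : Finset W := C.image Prod.fst ∪ C.image Prod.snd

/-- `C` is the edge set of a cycle, of length at least two, of the undirected interpretation of
`E`. A pair of antiparallel edges is a cycle of length two. -/
def IsCycle (E C : Finset (W × W)) : Prop :=
  ∃ (n : ℕ) (p : Fin (n + 2) → W) (e : Fin (n + 2) → W × W),
    Function.Injective p ∧ Function.Injective e ∧
    (∀ k, e k ∈ E ∧ (e k = (p k, p (k + 1)) ∨ e k = (p (k + 1), p k))) ∧
    C = Finset.univ.image e

/-- The (undirected) cycles of `E`, as edge sets. -/
def cycles (E : Finset (W × W)) : Finset (Finset (W × W)) :=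
  E.powerset.filter fun C => IsCycle E C

/-- The edges that lie on no cycle. -/
def forestEdges (E : Finset (W × W)) : Finset (W × W) :=
  E.filter fun e => ∀ C ∈ cycles E, e ∉ C

/-- Cactus graphs: nonempty connected graphs without loops in which two distinct cycles of the
undirected interpretation have at most one node in common. -/
structure IsCactus (E : Finset (W × W)) : Prop where
  nonempty : Nonempty W
  connected : ∀ i j, Relation.ReflTransGen (fun a b => (a, b) ∈ E ∨ (b, a) ∈ E) i j
  loopless : ∀ i, (i, i) ∉ E
  cycles_inter : ∀ C ∈ cycles E, ∀ C' ∈ cycles E, C ≠ C' → (verts C ∩ verts C').card ≤ 1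

/-- The tail of edge `e` after the edges in `rev` have been reversed. -/
def tail (rev : Finset (W × W)) (e : W × W) : W := if e ∈ rev then e.2 else e.1

/-- The head of edge `e` after the edges in `rev` have been reversed. -/
def head (rev : Finset (W × W)) (e : W × W) : W := if e ∈ rev then e.1 else e.2

/-- A rooted acyclic reorientation of `(W, E)`: some edges are reversed such that there is no
directed cycle and each node can be reached from the root. -/
structure Reorientation (E : Finset (W × W)) where
  root : W
  rev : Finset (W × W)
  acyclic : ∀ i, ¬ Relation.TransGen (fun a b => ∃ e ∈ E, tail rev e = a ∧ head rev e = b) i i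
  reach : ∀ i, Relation.ReflTransGen (fun a b => ∃ e ∈ E, tail rev e = a ∧ head rev e = b) root i

/-- `t` is the node of the cycle `C` at which both branches of the reoriented cycle end: no edge
of `C` leaves `t`. -/
def IsTarget {E : Finset (W × W)} (o : Reorientation E) (C : Finset (W × W)) (t : W) : Prop :=
  t ∈ verts C ∧ ∀ e ∈ C, tail o.rev e ≠ t

/-- The target of a cycle (it is unique in a cactus graph). -/
def target {E : Finset (W × W)} (o : Reorientation E) (C : Finset (W × W)) : W :=
  if h : ∃ t, IsTarget o C t then h.choose else o.root

/-! ### The linear programs -/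

/-- Variables of the multi-commodity flow formulation for one (sub)graph: embedding `x`, node
mapping `y i u`, flow `z (i, j) (u, v)` and allocations `a`. -/
structure MCFVars (W V T : Type*) where
  x : ℝ
  y : W → V → ℝ
  z : W × W → V × V → ℝ
  a : Res V T → ℝ

/-- The constraints of the multi-commodity flow formulation, without the capacity constraints,
for the subgraph `(N, F)` of the request `q`. -/
structure MCFVars.Feasible (q : Request S W) (N : Finset W) (F : Finset (W × W))
    (v : MCFVars W V T) : Prop where
  x_mem : v.x ∈ Set.Icc (0 : ℝ) 1
  y_mem : ∀ i ∈ N, ∀ u, v.y i u ∈ Set.Icc (0 : ℝ) 1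
  z_mem : ∀ e ∈ F, ∀ f ∈ S.E, v.z e f ∈ Set.Icc (0 : ℝ) 1
  a_nonneg : ∀ ρ ∈ S.resources, 0 ≤ v.a ρ
  node : ∀ i ∈ N, ∑ u ∈ q.loc i, v.y i u = v.x
  node_forbidden : ∀ i ∈ N, ∑ u ∈ (q.loc i)ᶜ, v.y i u = 0
  flow : ∀ e ∈ F, ∀ u,
    (∑ f ∈ S.E with f.1 = u, v.z e f) - (∑ f ∈ S.E with f.2 = u, v.z e f)
      = v.y e.1 u - v.y e.2 u
  edge_forbidden : ∀ e ∈ F, ∀ f ∈ S.E \ q.eloc e, v.z e f = 0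
  load_node : ∀ τ, ∀ u ∈ S.host τ,
    ∑ i ∈ N with q.type i = τ, q.nodeDemand i * v.y i u = v.a (Sum.inl (τ, u))
  load_edge : ∀ f ∈ S.E, ∑ e ∈ F, q.edgeDemand e * v.z e f = v.a (Sum.inr f)

/-- Variables of the novel formulation for one request: the global variables `x`, `y`, `a`, the
variables of the sub-LP for the forest, and those of the sub-LP for each cycle `C` and each
potential location `w` of its target. -/
structure LPVars (W V T : Type*) where
  x : ℝ
  y : W → V → ℝ
  a : Res V T → ℝ
  forest : MCFVars W V T
  cyc : Finset (W × W) → V → MCFVars W V T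

/-- The constraints of the novel formulation that concern a single request. The forest is the
spanning subgraph that remains after the edges of all cycles have been removed. -/
structure LPVars.Feasible (q : Request S W) (o : Reorientation q.E) (v : LPVars W V T) :
    Prop where
  x_mem : v.x ∈ Set.Icc (0 : ℝ) 1
  y_mem : ∀ i u, v.y i u ∈ Set.Icc (0 : ℝ) 1
  a_nonneg : ∀ ρ ∈ S.resources, 0 ≤ v.a ρ
  forest_lp : v.forest.Feasible q Finset.univ (forestEdges q.E)
  cycle_lp : ∀ C ∈ cycles q.E, ∀ w ∈ q.loc (target o C), (v.cyc C w).Feasible q (verts C) C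
  node : ∀ i, v.x = ∑ u ∈ q.loc i, v.y i u
  node_forest : ∀ i, ∀ u ∈ q.loc i, v.y i u = v.forest.y i u
  node_cycle : ∀ C ∈ cycles q.E, ∀ i ∈ verts C, ∀ u ∈ q.loc i,
    v.y i u = ∑ w ∈ q.loc (target o C), (v.cyc C w).y i u
  node_target : ∀ C ∈ cycles q.E, ∀ w ∈ q.loc (target o C), ∀ u ∈ q.loc (target o C) \ {w},
    (v.cyc C w).y (target o C) u = 0
  load_node : ∀ τ, ∀ u ∈ S.host τ,
    v.a (Sum.inl (τ, u)) = ∑ i with q.type i = τ, q.nodeDemand i * v.y i u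
  load_edge : ∀ f ∈ S.E, v.a (Sum.inr f) = v.forest.a (Sum.inr f) +
    ∑ C ∈ cycles q.E, ∑ w ∈ q.loc (target o C), (v.cyc C w).a (Sum.inr f)

end VNEP

namespace VNEP

variable {V T R : Type*} [Fintype V] [Fintype T] [Fintype R] {S : Substrate V T}
  {W : R → Type*} [∀ r, Fintype (W r)] (Q : ∀ r, Request S (W r))

/-- The novel LP for the requests in `A`, including the capacity constraints. -/
def LPFeasible (o : ∀ r, Reorientation (Q r).E) (A : Finset R) (v : ∀ r, LPVars (W r) V T) :
    Prop :=
  (∀ r ∈ A, (v r).Feasible (Q r) (o r)) ∧ ∀ ρ ∈ S.resources, ∑ r ∈ A, (v r).a ρ ≤ S.cap ρ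

/-- `v` is an optimal solution of the novel LP for the requests in `A` with objective
`max ∑ r ∈ A, b r * x_r`. -/
def IsLPOptimal (o : ∀ r, Reorientation (Q r).E) (A : Finset R) (b : R → ℝ)
    (v : ∀ r, LPVars (W r) V T) : Prop :=
  LPFeasible Q o A v ∧
  ∀ v', LPFeasible Q o A v' → ∑ r ∈ A, b r * (v' r).x ≤ ∑ r ∈ A, b r * (v r).x

/-- Preprocessing: a request is kept unless the LP for this request alone, maximizing `x_r`, has
optimal value less than `1`. -/
def kept (o : ∀ r, Reorientation (Q r).E) : Finset R :=
  Finset.univ.filter fun r => ∃ v, IsLPOptimal Q o {r} (fun _ => 1) v ∧ ¬ (v r).x < 1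

/-! ### Solutions -/

/-- A solution selects for each request a valid mapping or rejects the request (`none`). -/
abbrev Solution := ∀ r, Option (ValidMapping (Q r))

variable {Q}

/-- The profit of a solution. -/
def profit (s : Solution Q) : ℝ := ∑ r, if (s r).isSome then (Q r).profit else 0

/-- The cumulative allocation of a solution on a resource. -/
def load (s : Solution Q) (ρ : Res V T) : ℝ := ∑ r, (s r).elim 0 fun m => alloc m ρ

/-- Feasible embeddings respect all capacities. -/
def IsFeasible (s : Solution Q) : Prop := ∀ ρ ∈ S.resources, load s ρ ≤ S.cap ρ

variable (Q) in
/-- The optimal profit of the virtual network embedding problem. -/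
def optProfit : ℝ := sSup (profit '' {s : Solution Q | IsFeasible s})

/-- `s` achieves at least the factor `α` of the reference profit `b`, and exceeds node and edge
capacities at most by the factors `β` and `γ`. -/
def IsApprox (b α β γ : ℝ) (s : Solution Q) : Prop :=
  α * b ≤ profit s ∧ (∀ ρ ∈ S.nodeRes, load s ρ ≤ β * S.cap ρ) ∧
    ∀ ρ ∈ S.edgeRes, load s ρ ≤ γ * S.cap ρ

/-! ### The augmentation factors -/

variable (Q)

/-- The least `ε ≥ 0` with `maxDemand / cap ≤ ε` for all resources and all requests in `A`. -/
def eps (A : Finset R) : ℝ :=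
  sSup (insert 0 {t | ∃ r ∈ A, ∃ ρ ∈ S.resources, t = maxDemand (Q r) ρ / S.cap ρ})

/-- `Δ(ρ)`, summed over the requests in `A`. -/
def Delta (A : Finset R) (ρ : Res V T) : ℝ :=
  ∑ r ∈ A with 0 < maxDemand (Q r) ρ, (maxAlloc (Q r) ρ / maxDemand (Q r) ρ) ^ 2

/-- `Δ(X) = max_{ρ ∈ X} Δ(ρ)` (`0` for empty `X`). -/
def DeltaMax (A : Finset R) (X : Finset (Res V T)) : ℝ :=
  sSup (insert 0 {t | ∃ ρ ∈ X, t = Delta Q A ρ})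

/-- The factor `β` for node resources. -/
def beta (A : Finset R) : ℝ :=
  1 + eps Q A *
    Real.sqrt (2 * DeltaMax Q A S.nodeRes * Real.log (Fintype.card V * Fintype.card T))

/-- The factor `γ` for edge resources. -/
def gamma (A : Finset R) : ℝ :=
  1 + eps Q A * Real.sqrt (2 * DeltaMax Q A S.edgeRes * Real.log S.E.card)

end VNEP

/-! ### Decomposition and randomized rounding -/

namespace VNEP

variable {V T W : Type*} [Fintype V] [Fintype T] [Fintype W] {S : Substrate V T}

/-- A convex combination of valid mappings of a request: the mapping `m` has the weight
`weight m`, the remaining weight belongs to rejecting the request. -/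
structure ConvexComb (q : Request S W) where
  weight : ValidMapping q → ℝ≥0
  sum_le_one : ∑ m, weight m ≤ 1

/-- `D` decomposes the LP solution `v` of a request: it is complete, and its allocations are
bounded by those of `v`. -/
def IsDecomposition {q : Request S W} (v : LPVars W V T) (D : ConvexComb q) : Prop :=
  ∑ m, (D.weight m : ℝ) = v.x ∧
  ∀ ρ ∈ S.resources, ∑ m, (D.weight m : ℝ) * alloc m ρ ≤ v.a ρ

/-- Select `m` with probability `weight m`; reject with the remaining probability. -/
def ConvexComb.select {q : Request S W} (D : ConvexComb q) : PMF (Option (ValidMapping q)) :=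
  PMF.ofFintype
    (fun c => ((c.elim (1 - ∑ m, D.weight m) D.weight : ℝ≥0) : ℝ≥0∞))
    (by
      rw [← ENNReal.ofNNReal_finsetSum, Fintype.sum_option]
      simp only [Option.elim]
      rw [tsub_add_cancel_of_le D.sum_le_one, ENNReal.coe_one])

/-- Independent choices. -/
def productPMF {ι : Type*} [Fintype ι] {α : ι → Type*} [∀ i, Fintype (α i)]
    (p : ∀ i, PMF (α i)) : PMF (∀ i, α i) :=
  PMF.ofFintype (fun s => ∏ i, p i (s i))
    (by
      rw [← Fintype.prod_sum]
      refine Finset.prod_eq_one fun i _ => ?_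
      rw [← tsum_fintype (L := .unconditional _), (p i).tsum_coe])

end VNEP

namespace VNEP

variable {V T R : Type*} [Fintype V] [Fintype T] [Fintype R] {S : Substrate V T}
  {W : R → Type*} [∀ r, Fintype (W r)] {Q : ∀ r, Request S (W r)}

/-- One rounding try: independently for each request in `A` a mapping is selected according to
`D r`, all other requests are rejected. -/
def roundOnce (A : Finset R) (D : ∀ r, ConvexComb (Q r)) : PMF (Solution Q) :=
  productPMF fun r => if r ∈ A then (D r).select else PMF.pure none

/-- The do-while loop of the rounding algorithm: a solution is drawn; if it is not good and
further tries are left, the procedure is repeated. The solution that was drawn last is returned.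
The number counts the tries that are left after the first one. -/
def roundLoop (round : PMF (Solution Q)) (good : Solution Q → Prop) : ℕ → PMF (Solution Q)
  | 0 => round
  | n + 1 => round.bind fun s => if good s then PMF.pure s else roundLoop round good n

end VNEP

end

/-!
The theorem combines an exact decomposition of the LP solutions with tail bounds.

*Decomposition.* An LP solution of a cactus request is a convex combination of valid mappings.
For a single edge this is flow decomposition (`exists_flowDecomposition`). Weights on partial
mappings that agree on their common coordinates are glued by choosing the two parts independently
given the common coordinates (`exists_glue`, `Realizes.glue`); for a single common node agreement
just means that the node variables coincide. In the copy `[C, w]` the target of the cycle `C` is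
fixed at `w`, so `C` can be traversed from the target, gluing edge by edge: the last edge returns
to a node whose location is deterministic (`exists_realizes_cycle`). Finally the blocks of the
cactus, that is, its cycles and its remaining edges, are glued one by one. Each further block
meets the connected part that is already covered in exactly one node, as otherwise there were a
cycle sharing two nodes with the block (`IsCactus.not_conn_sdiff_block`,
`exists_realizes_cactus`). Only the existence of a target matters, so every reorientation will do.

*Optimal solutions.* Conversely, weights on valid mappings induce an LP solution (`lpOf_feasible`).
Hence the LP amounts to optimizing over the compact set of convex combinations that respect the
capacities (`exists_isLPOptimal`), it bounds the profit of all feasible solutions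
(`optProfit_le`), and its profit is at least that of each kept request (`profit_le_of_mem_kept`).

*Rounding.* The expected loads of a try are within the capacities, and Hoeffding's inequality
bounds the probability to overload one of `n` resources by `n⁻⁴` for each of them, hence by `n⁻³`
in total (`roundOnce_overload`). This is at most `1 / 27` for the nodes and `1 / 8` for the edges.
The expected profit is the LP profit, which exceeds each single profit, and an exponential moment
bounds the probability of less than a third of it by `exp (e⁻¹ - 2 / 3) ≤ 39 / 50`
(`roundOnce_profit`). The weaker Chernoff bound `exp (-2 / 9)` would not suffice for a substrate
with two edges. The three probabilities add up to less than `19 / 20`, and the tries are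
independent (`roundOnce_fail`, `roundLoop_fail`).
-/

noncomputable section

namespace VNEP

/-! ### Walks and cycles -/

section Walks

variable {α : Type*} {r : α → α → Prop}

/-- The sequence `q` follows the relation `r` for `n` steps. -/
def IsWalk (r : α → α → Prop) (n : ℕ) (q : ℕ → α) : Prop :=
  ∀ k < n, r (q k) (q (k + 1))

theorem exists_isWalk {a b : α} (h : Relation.ReflTransGen r a b) :
    ∃ n q, IsWalk r n q ∧ q 0 = a ∧ q n = b := by
  induction h with
  | refl => exact ⟨0, fun _ => a, fun k hk => absurd hk (Nat.not_lt_zero k), rfl, rfl⟩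
  | @tail b c _ hbc ih =>
    obtain ⟨n, q, hq, h0, hn⟩ := ih
    refine ⟨n + 1, fun k => if k ≤ n then q k else c, fun k hk => ?_, by simpa using h0, by simp⟩
    rcases Nat.lt_succ_iff_lt_or_eq.mp hk with h | rfl
    · simp only [h.le, if_true, Nat.succ_le_of_lt h]
      exact hq k h
    · simpa [hn] using hbc

theorem IsWalk.reflTransGen {n : ℕ} {q : ℕ → α} (h : IsWalk r n q) {k : ℕ} (hk : k ≤ n) :
    Relation.ReflTransGen r (q 0) (q k) := by
  induction k with
  | zero => exact .refl
  | succ k ih => exact (ih (by omega)).tail (h k (by omega))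

/-- A walk that visits a node twice can be shortened by cutting out the detour. -/
theorem IsWalk.shortcut {n : ℕ} {q : ℕ → α} (h : IsWalk r n q) {s t : ℕ} (hst : s < t)
    (ht : t ≤ n) (he : q s = q t) :
    ∃ q', IsWalk r (n - (t - s)) q' ∧ q' 0 = q 0 ∧ q' (n - (t - s)) = q n := by
  refine ⟨fun k => if k ≤ s then q k else q (k + (t - s)), fun k hk => ?_, by simp, ?_⟩
  · rcases lt_trichotomy k s with hks | rfl | hks
    · simp only [hks.le, if_true, Nat.succ_le_of_lt hks]
      exact h k (by omega)
    · have h2 : k + 1 + (t - k) = t + 1 := by omega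
      simp only [le_refl, if_true, Nat.not_succ_le_self, if_false, h2, he]
      exact h t (by omega)
    · have h1 : ¬ k ≤ s := by omega
      have h2 : ¬ k + 1 ≤ s := by omega
      have h3 : k + 1 + (t - s) = k + (t - s) + 1 := by omega
      simp only [h1, h2, if_false, h3]
      exact h _ (by omega)
  · by_cases hn : n - (t - s) ≤ s
    · have h1 : n - (t - s) = s := by omega
      have h2 : t = n := by omega
      simp only [hn, if_true]
      rw [h1, he, h2]
    · have h1 : n - (t - s) + (t - s) = n := by omega
      simp only [hn, if_false, h1]

/-- A shortest walk among those with prescribed pairs of ends is a path. -/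
theorem IsWalk.injOn_of_minimal {n : ℕ} {q : ℕ → α} (h : IsWalk r n q)
    (hmin : ∀ m < n, ∀ q', IsWalk r m q' → q' 0 = q 0 → q' m ≠ q n) :
    Set.InjOn q (Set.Iic n) := by
  have key : ∀ s t, s < t → t ≤ n → q s ≠ q t := by
    intro s t hst ht he
    obtain ⟨q', h1, h2, h3⟩ := h.shortcut hst ht he
    exact hmin _ (by omega) q' h1 h2 h3
  intro s hs t ht he
  rcases lt_trichotomy s t with hst | hst | hst
  · exact absurd he (key s t hst ht)
  · exact hst
  · exact absurd he.symm (key t s hst hs)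

theorem exists_isPath {a b : α} (h : Relation.ReflTransGen r a b) :
    ∃ n q, IsWalk r n q ∧ Set.InjOn q (Set.Iic n) ∧ q 0 = a ∧ q n = b := by
  have hex : ∃ n, ∃ q, IsWalk r n q ∧ q 0 = a ∧ q n = b := exists_isWalk h
  obtain ⟨q, hq, h0, hn⟩ := Nat.find_spec hex
  refine ⟨Nat.find hex, q, hq, hq.injOn_of_minimal fun m hm q' hq' h0' hn' => ?_, h0, hn⟩
  exact Nat.find_min hex hm ⟨q', hq', h0'.trans h0, hn'.trans hn⟩

end Walks

section Cycles

variable {W : Type*} {E B C : Finset (W × W)}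

/-- Adjacency in the undirected interpretation of `F`. -/
def Adj (F : Finset (W × W)) (a b : W) : Prop := (a, b) ∈ F ∨ (b, a) ∈ F

theorem Adj.symm {F : Finset (W × W)} {a b : W} (h : Adj F a b) : Adj F b a := Or.symm h

theorem Adj.mono {F F' : Finset (W × W)} (hF : F ⊆ F') {a b : W} (h : Adj F a b) :
    Adj F' a b := h.imp (fun h => hF h) (fun h => hF h)

theorem conn_symm {F : Finset (W × W)} {a b : W} (h : Relation.ReflTransGen (Adj F) a b) :
    Relation.ReflTransGen (Adj F) b a := by
  induction h with
  | refl => exact .refl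
  | tail _ h ih => exact .head h.symm ih

theorem conn_mono {F F' : Finset (W × W)} (hF : F ⊆ F') {a b : W}
    (h : Relation.ReflTransGen (Adj F) a b) : Relation.ReflTransGen (Adj F') a b := by
  induction h with
  | refl => exact .refl
  | tail _ h ih => exact ih.tail (h.mono hF)

theorem mem_verts {a : W} : a ∈ verts C ↔ ∃ e ∈ C, e.1 = a ∨ e.2 = a := by
  simp only [verts, Finset.mem_union, Finset.mem_image]
  constructor
  · rintro (⟨e, he, h⟩ | ⟨e, he, h⟩)
    exacts [⟨e, he, .inl h⟩, ⟨e, he, .inr h⟩]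
  · rintro ⟨e, he, h | h⟩
    exacts [.inl ⟨e, he, h⟩, .inr ⟨e, he, h⟩]

theorem fst_mem_verts {e : W × W} (he : e ∈ C) : e.1 ∈ verts C := mem_verts.2 ⟨e, he, .inl rfl⟩

theorem snd_mem_verts {e : W × W} (he : e ∈ C) : e.2 ∈ verts C := mem_verts.2 ⟨e, he, .inr rfl⟩

theorem Adj.exists_edge {F : Finset (W × W)} {a b : W} (h : Adj F a b) :
    ∃ e ∈ F, e = (a, b) ∨ e = (b, a) := by
  rcases h with h | h
  exacts [⟨_, h, .inl rfl⟩, ⟨_, h, .inr rfl⟩]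

theorem isCycle_of_seq {L : ℕ} (hL : 2 ≤ L) {r : ℕ → W} {g : ℕ → W × W}
    (hr : Set.InjOn r (Set.Iio L)) (hg : Set.InjOn g (Set.Iio L)) (hclose : r L = r 0)
    (h : ∀ k < L, g k ∈ E ∧ (g k = (r k, r (k + 1)) ∨ g k = (r (k + 1), r k))) :
    IsCycle E ((Finset.range L).image g) := by
  obtain ⟨n, rfl⟩ := Nat.exists_eq_add_of_le' hL
  refine ⟨n, fun k => r k, fun k => g k, fun i j hij => Fin.ext (hr i.2 j.2 hij),
    fun i j hij => Fin.ext (hg i.2 j.2 hij), fun k => ⟨(h k k.2).1, ?_⟩, ?_⟩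
  · have : r ((k + 1 : Fin (n + 2)) : ℕ) = r (k + 1) := by
      rw [Fin.val_add_one]
      split_ifs with hk
      · subst hk
        simpa using hclose.symm
      · rfl
    simpa only [this] using (h k k.2).2
  · ext e
    simp only [Finset.mem_image, Finset.mem_range, Finset.mem_univ, true_and]
    constructor
    · rintro ⟨k, hk, rfl⟩
      exact ⟨⟨k, hk⟩, rfl⟩
    · rintro ⟨k, rfl⟩
      exact ⟨k, k.2, rfl⟩

open Fin.NatCast in
/-- A cycle can be traversed starting from any of its nodes. -/
theorem IsCycle.exists_seq (h : IsCycle E C) {t : W} (ht : t ∈ verts C) :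
    ∃ (L : ℕ) (r : ℕ → W) (g : ℕ → W × W), Set.InjOn r (Set.Iio L) ∧
      Set.InjOn g (Set.Iio L) ∧ r 0 = t ∧ r L = t ∧
      (∀ k < L, g k ∈ E ∧ (g k = (r k, r (k + 1)) ∨ g k = (r (k + 1), r k))) ∧
      C = (Finset.range L).image g := by
  obtain ⟨n, p, e, hp, he, hpe, rfl⟩ := h
  obtain ⟨i, rfl⟩ : ∃ i, p i = t := by
    obtain ⟨e', he', h⟩ := mem_verts.1 ht
    obtain ⟨k, -, rfl⟩ := Finset.mem_image.1 he'
    rcases (hpe k).2 with h' | h' <;> rw [h'] at h <;> rcases h with h | h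
    exacts [⟨_, h⟩, ⟨_, h⟩, ⟨_, h⟩, ⟨_, h⟩]
  have hcast : ∀ a < n + 2, ∀ b < n + 2, i + (a : Fin (n + 2)) = i + (b : Fin (n + 2)) →
      a = b := by
    intro a ha b hb hab
    have := congrArg Fin.val (add_left_cancel hab)
    rwa [Fin.val_natCast, Fin.val_natCast, Nat.mod_eq_of_lt ha, Nat.mod_eq_of_lt hb] at this
  have hsucc : ∀ k : ℕ, i + ((k + 1 : ℕ) : Fin (n + 2)) = i + (k : Fin (n + 2)) + 1 := by
    intro k
    rw [add_assoc]
    congr 1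
    apply Fin.ext
    simp [Fin.val_natCast, Fin.val_add]
  refine ⟨n + 2, fun k => p (i + (k : Fin (n + 2))), fun k => e (i + (k : Fin (n + 2))),
    fun a ha b hb hab => hcast a ha b hb (hp hab), fun a ha b hb hab => hcast a ha b hb (he hab),
    by simp, ?_, fun k _ => ?_, ?_⟩
  · have : ((n + 2 : ℕ) : Fin (n + 2)) = 0 := by
      apply Fin.ext
      simp
    simp only [this, add_zero]
  · simp only [hsucc]
    exact hpe _
  · ext f
    simp only [Finset.mem_image, Finset.mem_range, Finset.mem_univ, true_and]
    constructor
    · rintro ⟨k, rfl⟩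
      refine ⟨(k - i : Fin (n + 2)), Fin.isLt _, ?_⟩
      congr 1
      rw [Fin.cast_val_eq_self]
      abel
    · rintro ⟨k, -, rfl⟩
      exact ⟨_, rfl⟩

theorem IsCycle.conn (h : IsCycle E C) {a b : W} (ha : a ∈ verts C) (hb : b ∈ verts C) :
    Relation.ReflTransGen (Adj C) a b := by
  obtain ⟨L, r, g, -, -, h0, hL, hg, rfl⟩ := h.exists_seq ha
  have hw : IsWalk (Adj ((Finset.range L).image g)) L r := by
    intro k hk
    have hk' := Finset.mem_image_of_mem g (Finset.mem_range.2 hk)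
    rcases (hg k hk).2 with h | h <;> rw [h] at hk'
    exacts [.inl hk', .inr hk']
  obtain ⟨e, he, hb⟩ := mem_verts.1 hb
  obtain ⟨k, hk, rfl⟩ := Finset.mem_image.1 he
  rw [Finset.mem_range] at hk
  have h1 := h0 ▸ hw.reflTransGen hk.le
  have h2 := h0 ▸ hw.reflTransGen (Nat.succ_le_of_lt hk)
  rcases (hg k hk).2 with h | h <;> rw [h] at hb <;> rcases hb with rfl | rfl <;> assumption

/-- Two paths with the same ends, one inside `B` and one outside `B` whose inner nodes avoid
`B`, form a cycle. -/
theorem exists_cycle_of_two_paths (hB : B ⊆ E) {a b : W} (hab : a ≠ b) {m l : ℕ} {q p : ℕ → W}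
    (hq : IsWalk (Adj (E \ B)) m q) (hqi : Set.InjOn q (Set.Iic m)) (hq0 : q 0 = a)
    (hqm : q m = b) (hqB : ∀ k, 0 < k → k < m → q k ∉ verts B)
    (hp : IsWalk (Adj B) l p) (hpi : Set.InjOn p (Set.Iic l)) (hp0 : p 0 = b) (hpl : p l = a) :
    ∃ C ∈ cycles E, a ∈ verts C ∧ b ∈ verts C ∧ (∃ e ∈ C, e ∉ B) ∧ ∃ e ∈ C, e ∈ B := by
  have hm : 0 < m := Nat.pos_of_ne_zero fun h => hab (by rw [← hq0, ← hqm, h])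
  have hl : 0 < l := Nat.pos_of_ne_zero fun h => hab (by rw [← hp0, ← hpl, h])
  have h1 : ∀ k, ∃ e, k < m → e ∈ E \ B ∧ (e = (q k, q (k + 1)) ∨ e = (q (k + 1), q k)) := by
    intro k
    by_cases hk : k < m
    · obtain ⟨e, he, h⟩ := (hq k hk).exists_edge
      exact ⟨e, fun _ => ⟨he, h⟩⟩
    · exact ⟨(a, a), fun h => absurd h hk⟩
  have h2 : ∀ k, ∃ e, k < l → e ∈ B ∧ (e = (p k, p (k + 1)) ∨ e = (p (k + 1), p k)) := by
    intro k
    by_cases hk : k < l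
    · obtain ⟨e, he, h⟩ := (hp k hk).exists_edge
      exact ⟨e, fun _ => ⟨he, h⟩⟩
    · exact ⟨(a, a), fun h => absurd h hk⟩
  choose gq hgq using h1
  choose gp hgp using h2
  have hpv : ∀ k ≤ l, p k ∈ verts B := by
    intro k hk
    rcases Nat.eq_or_lt_of_le hk with rfl | hk
    · have := hgp (k - 1) (by omega)
      rw [Nat.sub_add_cancel hl] at this
      rcases this.2 with h | h
      · have := snd_mem_verts this.1; rwa [h] at this
      · have := fst_mem_verts this.1; rwa [h] at this
    · have := hgp k hk
      rcases this.2 with h | h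
      · have := fst_mem_verts this.1; rwa [h] at this
      · have := snd_mem_verts this.1; rwa [h] at this
  have hqp : ∀ s < m, ∀ t < l, q s ≠ p t := by
    intro s hs t ht he
    rcases Nat.eq_zero_or_pos s with rfl | hs0
    · rw [hq0, ← hpl] at he
      exact ht.ne' (hpi (Set.mem_Iic.2 le_rfl) (Set.mem_Iic.2 ht.le) he)
    · exact hqB s hs0 hs (he ▸ hpv t ht.le)
  -- consecutive pairs of a path determine the position
  have hinj : ∀ (n : ℕ) (x : ℕ → W), Set.InjOn x (Set.Iic n) → ∀ e : W × W, ∀ s < n, ∀ t < n,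
      (e = (x s, x (s + 1)) ∨ e = (x (s + 1), x s)) →
      (e = (x t, x (t + 1)) ∨ e = (x (t + 1), x t)) → s = t := by
    intro n x hx e s hs t ht h1 h2
    have key : ∀ i ≤ n, ∀ j ≤ n, x i = x j → i = j := fun i hi j hj h => hx hi hj h
    rcases h1 with h1 | h1 <;> rcases h2 with h2 | h2 <;> rw [h1, Prod.mk.injEq] at h2
    · exact key _ hs.le _ ht.le h2.1
    · have := key _ hs.le _ (Nat.succ_le_of_lt ht) h2.1
      have := key _ (Nat.succ_le_of_lt hs) _ ht.le h2.2
      omega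
    · have := key _ (Nat.succ_le_of_lt hs) _ ht.le h2.1
      have := key _ hs.le _ (Nat.succ_le_of_lt ht) h2.2
      omega
    · exact key _ hs.le _ ht.le h2.2
  set r : ℕ → W := fun t => if t < m then q t else p (t - m) with hr
  set g : ℕ → W × W := fun t => if t < m then gq t else gp (t - m) with hg
  have hcyc : IsCycle E ((Finset.range (m + l)).image g) := by
    refine isCycle_of_seq (r := r) (by omega) ?_ ?_ ?_ ?_
    · intro s hs t ht he
      rw [Set.mem_Iio] at hs ht
      simp only [hr] at he
      split_ifs at he with h1 h2 h2
      · exact hqi (Set.mem_Iic.2 h1.le) (Set.mem_Iic.2 h2.le) he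
      · exact absurd he (hqp s h1 _ (by omega))
      · exact absurd he.symm (hqp t h2 _ (by omega))
      · have := hpi (Set.mem_Iic.2 (by omega)) (Set.mem_Iic.2 (by omega)) he
        omega
    · intro s hs t ht he
      rw [Set.mem_Iio] at hs ht
      simp only [hg] at he
      split_ifs at he with h1 h2 h2
      · exact hinj m q hqi _ s h1 t h2 (hgq s h1).2 (he ▸ (hgq t h2).2)
      · exact absurd (hgp (t - m) (by omega)).1 (he ▸ (Finset.mem_sdiff.1 (hgq s h1).1).2)
      · exact absurd (hgp (s - m) (by omega)).1 (he ▸ (Finset.mem_sdiff.1 (hgq t h2).1).2)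
      · have := hinj l p hpi _ (s - m) (by omega) (t - m) (by omega)
          (hgp (s - m) (by omega)).2 (he ▸ (hgp (t - m) (by omega)).2)
        omega
    · simp [hr, hm, hpl, hq0]
    · intro k hk
      rcases lt_or_ge k m with h1 | h1
      · have h2 : r (k + 1) = q (k + 1) := by
          simp only [hr]
          split_ifs with h
          · rfl
          · have : k + 1 = m := by omega
            rw [this, Nat.sub_self, hp0, hqm]
        simp only [h2]
        simp only [hr, hg, h1, if_true]
        exact ⟨(Finset.mem_sdiff.1 (hgq k h1).1).1, (hgq k h1).2⟩
      · have h2 : ¬ k < m := by omega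
        have h3 : ¬ k + 1 < m := by omega
        have h4 : k + 1 - m = k - m + 1 := by omega
        simp only [hr, hg, h2, h3, h4, if_false]
        have := hgp (k - m) (by omega)
        exact ⟨hB this.1, this.2⟩
  have hmem : ∀ k < m + l, g k ∈ (Finset.range (m + l)).image g := fun k hk =>
    Finset.mem_image_of_mem g (Finset.mem_range.2 hk)
  have hg0 : g 0 = gq 0 := by simp [hg, hm]
  have hgm : g m = gp 0 := by simp [hg]
  refine ⟨_, ?_, ?_, ?_, ⟨g 0, hmem 0 (by omega), ?_⟩, ⟨g m, hmem m (by omega), ?_⟩⟩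
  · refine Finset.mem_filter.2 ⟨Finset.mem_powerset.2 ?_, hcyc⟩
    obtain ⟨n, _, e, -, -, he, hC⟩ := hcyc
    rw [hC]
    intro f hf
    obtain ⟨k, -, rfl⟩ := Finset.mem_image.1 hf
    exact (he k).1
  · refine mem_verts.2 ⟨g 0, hmem 0 (by omega), ?_⟩
    rw [hg0]
    rcases (hgq 0 hm).2 with h | h <;> simp [h, hq0]
  · refine mem_verts.2 ⟨g m, hmem m (by omega), ?_⟩
    rw [hgm]
    rcases (hgp 0 hl).2 with h | h <;> simp [h, hp0]
  · rw [hg0]; exact (Finset.mem_sdiff.1 (hgq 0 hm).1).2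
  · rw [hgm]; exact (hgp 0 hl).1

theorem subset_of_mem_cycles (h : C ∈ cycles E) : C ⊆ E :=
  Finset.mem_powerset.1 (Finset.mem_filter.1 h).1

theorem isCycle_of_mem_cycles (h : C ∈ cycles E) : IsCycle E C := (Finset.mem_filter.1 h).2

theorem IsCactus.fst_ne_snd {E : Finset (W × W)} (hE : IsCactus E) {e : W × W} (he : e ∈ E) :
    e.1 ≠ e.2 := fun h => hE.loopless e.1 (by
  rwa [show e = (e.1, e.1) from Prod.ext rfl h.symm] at he)

theorem IsCactus.cycles_disjoint (hE : IsCactus E) {C C' : Finset (W × W)}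
    (hC : C ∈ cycles E) (hC' : C' ∈ cycles E) {e : W × W} (he : e ∈ C) (he' : e ∈ C') :
    C = C' := by
  by_contra hne
  have h2 : e.1 ≠ e.2 := hE.fst_ne_snd (subset_of_mem_cycles hC he)
  refine absurd (hE.cycles_inter C hC C' hC' hne) (not_le.2 (Finset.one_lt_card.2 ?_))
  exact ⟨e.1, Finset.mem_inter.2 ⟨fst_mem_verts he, fst_mem_verts he'⟩, e.2,
    Finset.mem_inter.2 ⟨snd_mem_verts he, snd_mem_verts he'⟩, h2⟩

variable [Fintype W]

/-- The blocks of a cactus graph: the cycles and the edges that lie on no cycle. -/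
def blocks (E : Finset (W × W)) : Finset (Finset (W × W)) :=
  cycles E ∪ (forestEdges E).image fun e => {e}

theorem subset_of_mem_blocks (h : B ∈ blocks E) : B ⊆ E := by
  rcases Finset.mem_union.1 h with h | h
  · exact subset_of_mem_cycles h
  · obtain ⟨e, he, rfl⟩ := Finset.mem_image.1 h
    exact Finset.singleton_subset_iff.2 (Finset.mem_filter.1 he).1

theorem exists_block {e : W × W} (he : e ∈ E) : ∃ B ∈ blocks E, e ∈ B := by
  by_cases h : e ∈ forestEdges E
  · exact ⟨{e}, Finset.mem_union_right _ (Finset.mem_image_of_mem _ h),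
      Finset.mem_singleton_self e⟩
  · have : ∃ C ∈ cycles E, e ∈ C := by
      by_contra! h'
      exact h (Finset.mem_filter.2 ⟨he, h'⟩)
    obtain ⟨C, hC, heC⟩ := this
    exact ⟨C, Finset.mem_union_left _ hC, heC⟩

theorem block_conn (h : B ∈ blocks E) {a b : W} (ha : a ∈ verts B) (hb : b ∈ verts B) :
    Relation.ReflTransGen (Adj B) a b := by
  rcases Finset.mem_union.1 h with h | h
  · exact (isCycle_of_mem_cycles h).conn ha hb
  · obtain ⟨e, he, rfl⟩ := Finset.mem_image.1 h
    have h1 : Relation.ReflTransGen (Adj {e}) e.1 e.2 := .single (.inl (by simp))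
    have h2 : ∀ x ∈ verts {e}, x = e.1 ∨ x = e.2 := by
      intro x hx
      simpa [verts] using hx
    rcases h2 a ha with rfl | rfl <;> rcases h2 b hb with rfl | rfl
    exacts [.refl, h1, conn_symm h1, .refl]

theorem block_verts_nonempty (h : B ∈ blocks E) : (verts B).Nonempty := by
  have : B.Nonempty := by
    rcases Finset.mem_union.1 h with h | h
    · obtain ⟨n, _, e, -, -, -, rfl⟩ := isCycle_of_mem_cycles h
      exact ⟨e 0, Finset.mem_image_of_mem _ (Finset.mem_univ _)⟩
    · obtain ⟨e, he, rfl⟩ := Finset.mem_image.1 h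
      exact ⟨e, Finset.mem_singleton_self e⟩
  obtain ⟨e, he⟩ := this
  exact ⟨e.1, fst_mem_verts he⟩

theorem IsCactus.blocks_disjoint (hE : IsCactus E) {B B' : Finset (W × W)}
    (hB : B ∈ blocks E) (hB' : B' ∈ blocks E) {e : W × W} (he : e ∈ B) (he' : e ∈ B') :
    B = B' := by
  rcases Finset.mem_union.1 hB with h | h <;> rcases Finset.mem_union.1 hB' with h' | h'
  · exact hE.cycles_disjoint h h' he he'
  · obtain ⟨f, hf, rfl⟩ := Finset.mem_image.1 h'
    rw [Finset.mem_singleton.1 he'] at he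
    exact absurd he ((Finset.mem_filter.1 hf).2 _ h)
  · obtain ⟨f, hf, rfl⟩ := Finset.mem_image.1 h
    rw [Finset.mem_singleton.1 he] at he'
    exact absurd he' ((Finset.mem_filter.1 hf).2 _ h')
  · obtain ⟨f, hf, rfl⟩ := Finset.mem_image.1 h
    obtain ⟨f', hf', rfl⟩ := Finset.mem_image.1 h'
    rw [← Finset.mem_singleton.1 he, ← Finset.mem_singleton.1 he']

/-- Distinct nodes of a block are connected only through the block itself: a shortest connection
outside of it would close a further cycle. -/
theorem IsCactus.not_conn_sdiff_block (hE : IsCactus E) (hB : B ∈ blocks E) {a b : W}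
    (ha : a ∈ verts B) (hb : b ∈ verts B) (hab : a ≠ b) :
    ¬ Relation.ReflTransGen (Adj (E \ B)) a b := by
  intro hconn
  have hex : ∃ n, ∃ q, IsWalk (Adj (E \ B)) n q ∧ q 0 ∈ verts B ∧ q n ∈ verts B ∧ q 0 ≠ q n := by
    obtain ⟨n, q, hq, rfl, rfl⟩ := exists_isWalk hconn
    exact ⟨n, q, hq, ha, hb, hab⟩
  obtain ⟨q, hq, h0, hn, hne⟩ := Nat.find_spec hex
  set n := Nat.find hex
  have hmin : ∀ m < n, ∀ q', IsWalk (Adj (E \ B)) m q' → q' 0 ∈ verts B → q' m ∈ verts B →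
      q' 0 = q' m := by
    intro m hm q' h1 h2 h3
    by_contra h4
    exact Nat.find_min hex hm ⟨q', h1, h2, h3, h4⟩
  have hinj : Set.InjOn q (Set.Iic n) := hq.injOn_of_minimal fun m hm q' h1 h2 h3 => by
    refine hne ?_
    rw [← h2, ← h3]
    exact hmin m hm q' h1 (h2 ▸ h0) (h3 ▸ hn)
  obtain ⟨l, p, hp, hpi, hp0, hpl⟩ := exists_isPath (block_conn hB hn h0)
  obtain ⟨C, hC, haC, hbC, ⟨f, hfC, hfB⟩, e, heC, heB⟩ :=
    exists_cycle_of_two_paths (subset_of_mem_blocks hB) hne hq hinj rfl rfl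
      (fun k hk0 hk hv => by
        have := hmin k hk q (fun i hi => hq i (hi.trans hk)) h0 hv
        exact hk0.ne (hinj (Set.mem_Iic.2 (Nat.zero_le _)) (Set.mem_Iic.2 hk.le) this))
      hp hpi hp0 hpl
  have := hE.blocks_disjoint hB (Finset.mem_union_left _ hC) heB heC
  exact hfB (this ▸ hfC)

end Cycles

/-! ### Reorientations -/

section Orientation

variable {W : Type*} [Fintype W] {E : Finset (W × W)}

/-- Orient all edges away from the root along an injective numbering that refines the distance
from the root. -/
theorem IsCactus.nonempty_reorientation (hE : IsCactus E) : Nonempty (Reorientation E) := by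
  obtain ⟨root⟩ := hE.nonempty
  have hex : ∀ i, ∃ n, ∃ q, IsWalk (Adj E) n q ∧ q 0 = root ∧ q n = i := fun i =>
    exists_isWalk (hE.connected root i)
  set dist : W → ℕ := fun i => Nat.find (hex i)
  have hpred : ∀ i, i ≠ root → ∃ j, Adj E j i ∧ dist j < dist i := by
    intro i hi
    obtain ⟨q, hq, h0, hn⟩ := Nat.find_spec (hex i)
    change q (dist i) = i at hn
    change IsWalk _ (dist i) q at hq
    have hpos : 0 < dist i := Nat.pos_of_ne_zero fun h => hi (by rw [← hn, h, h0])
    have hs : dist i - 1 + 1 = dist i := Nat.sub_add_cancel hpos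
    refine ⟨q (dist i - 1), ?_, lt_of_le_of_lt ?_ (Nat.sub_lt hpos one_pos)⟩
    · have := hq (dist i - 1) (by omega)
      rwa [hs, hn] at this
    · exact Nat.find_min' (hex _) ⟨q, fun k hk => hq k (by omega), h0, rfl⟩
  set num : W → ℕ ×ₗ Fin (Fintype.card W) := fun i => toLex (dist i, Fintype.equivFin W i)
  have hnum : Function.Injective num := fun i j h =>
    (Fintype.equivFin W).injective (congrArg Prod.snd (toLex.injective h))
  have hlt : ∀ i j, dist i < dist j → num i < num j := fun i j h => by
    exact Prod.Lex.toLex_lt_toLex.2 (.inl h)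
  set rev : Finset (W × W) := E.filter fun e => num e.2 < num e.1
  have hinc : ∀ e ∈ E, num (tail rev e) < num (head rev e) := by
    intro e he
    by_cases h : num e.2 < num e.1
    · have : e ∈ rev := Finset.mem_filter.2 ⟨he, h⟩
      simpa [tail, head, this] using h
    · have h' : e ∉ rev := fun h' => h (Finset.mem_filter.1 h').2
      simp only [tail, head, h', if_false]
      exact lt_of_le_of_ne (not_lt.1 h) fun h => hE.fst_ne_snd he (hnum h)
  refine ⟨⟨root, rev, fun i hi => ?_, fun i => ?_⟩⟩
  · have : ∀ a b, Relation.TransGen (fun a b => ∃ e ∈ E, tail rev e = a ∧ head rev e = b) a b →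
        num a < num b := by
      intro a b h
      induction h with
      | single h => obtain ⟨e, he, rfl, rfl⟩ := h; exact hinc e he
      | tail _ h ih => obtain ⟨e, he, rfl, rfl⟩ := h; exact ih.trans (hinc e he)
    exact lt_irrefl _ (this i i hi)
  · induction h : dist i using Nat.strong_induction_on generalizing i with
    | _ n ih =>
      by_cases hi : i = root
      · exact hi ▸ .refl
      obtain ⟨j, hadj, hj⟩ := hpred i hi
      refine (ih (dist j) (h ▸ hj) j rfl).tail ?_
      obtain ⟨e, he, h' | h'⟩ := hadj.exists_edge
      · refine ⟨e, he, ?_⟩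
        have : e ∉ rev := fun h2 => (hlt j i hj).asymm (by
          simpa [h'] using (Finset.mem_filter.1 h2).2)
        simp only [tail, head, this, if_false]
        simp [h']
      · refine ⟨e, he, ?_⟩
        have : e ∈ rev := Finset.mem_filter.2 ⟨he, by simpa [h'] using hlt j i hj⟩
        simp only [tail, head, this, if_true]
        simp [h']

/-- A cycle has a target: otherwise each of its nodes had a successor on the cycle, in
contradiction to acyclicity. -/
theorem target_mem_verts (o : Reorientation E) {C : Finset (W × W)} (hC : C ∈ cycles E) :
    target o C ∈ verts C := by
  have hex : ∃ t, IsTarget o C t := by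
    set r : W → W → Prop := fun a b => ∃ e ∈ E, tail o.rev e = a ∧ head o.rev e = b
    have hirr : Std.Irrefl (Relation.TransGen r) := ⟨o.acyclic⟩
    have htr : IsTrans W (Relation.TransGen r) := inferInstance
    have hwf : WellFounded (Function.swap (Relation.TransGen r)) :=
      Finite.wellFounded_of_trans_of_irrefl _
    obtain ⟨v, hv⟩ := block_verts_nonempty (Finset.mem_union_left _ hC : C ∈ blocks E)
    obtain ⟨t, ht, hmin⟩ := hwf.has_min {t | t ∈ verts C} ⟨v, hv⟩
    refine ⟨t, ht, fun e he h => hmin (head o.rev e) ?_ ?_⟩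
    · show head o.rev e ∈ verts C
      unfold head
      split_ifs
      exacts [fst_mem_verts he, snd_mem_verts he]
    · exact .single ⟨e, subset_of_mem_cycles hC he, h, rfl⟩
  rw [target, dif_pos hex]
  exact hex.choose_spec.1

end Orientation

/-! ### Decomposition of a flow into paths -/

section Flow

variable {V : Type*}

theorem exists_isEdgePath {r : V → V → Prop} {a b : V} (h : Relation.ReflTransGen r a b) :
    ∃ P, IsEdgePath a b P ∧ ∀ f ∈ P, r f.1 f.2 := by
  obtain ⟨n, q, hq, hi, h0, hn⟩ := exists_isPath h
  refine ⟨_, ⟨n, fun k => q k, fun i j hij => Fin.ext (hi (Set.mem_Iic.2 (Nat.lt_succ_iff.1 i.2))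
    (Set.mem_Iic.2 (Nat.lt_succ_iff.1 j.2)) hij), by simpa using h0, by simpa using hn, rfl⟩, ?_⟩
  intro f hf
  obtain ⟨k, -, rfl⟩ := Finset.mem_image.1 hf
  simpa using hq k k.2

/-- The indicator function of a path is a unit flow between its ends. -/
theorem IsEdgePath.flow {u v : V} {P F : Finset (V × V)} (h : IsEdgePath u v P) (hP : P ⊆ F)
    (x : V) :
    (∑ f ∈ F with f.1 = x, if f ∈ P then (1 : ℝ) else 0) -
        (∑ f ∈ F with f.2 = x, if f ∈ P then (1 : ℝ) else 0) =
      (if u = x then 1 else 0) - (if v = x then 1 else 0) := by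
  have hF : ∀ p : V × V → Prop, (∑ f ∈ F with p f, if f ∈ P then (1 : ℝ) else 0) =
      ∑ f ∈ P, if p f then (1 : ℝ) else 0 := by
    intro p
    rw [Finset.sum_filter, ← Finset.sum_subset hP]
    · exact Finset.sum_congr rfl fun f hf => by simp [hf]
    · intro f _ hf
      simp [hf]
  rw [hF, hF]
  obtain ⟨n, p, hp, rfl, rfl, rfl⟩ := h
  have hinj : Function.Injective fun k : Fin n => (p k.castSucc, p k.succ) := fun i j hij =>
    Fin.castSucc_injective n (hp (Prod.mk.inj hij).1)
  rw [Finset.sum_image fun i _ j _ hij => hinj hij, Finset.sum_image fun i _ j _ hij => hinj hij]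
  have h1 := Fin.sum_univ_castSucc fun k => if p k = x then (1 : ℝ) else 0
  have h2 := Fin.sum_univ_succ fun k => if p k = x then (1 : ℝ) else 0
  simp only at h1 h2 ⊢
  linarith

theorem sum_sum_filter_eq {ι κ : Type*} (X : Finset κ) (F : Finset ι) (φ : ι → κ) (z : ι → ℝ) :
    ∑ x ∈ X, ∑ f ∈ F with φ f = x, z f = ∑ f ∈ F, if φ f ∈ X then z f else 0 := by
  simp only [Finset.sum_filter]
  rw [Finset.sum_comm]
  exact Finset.sum_congr rfl fun f _ => by rw [Finset.sum_ite_eq]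

variable [Fintype V]

/-- A source of a nonnegative flow reaches a sink along edges that carry flow: otherwise the
nodes that it reaches had a net outflow although no flow leaves them. -/
theorem exists_reachable_sink {F : Finset (V × V)} {z : V × V → ℝ} {y₁ y₂ : V → ℝ}
    (hz : ∀ f ∈ F, 0 ≤ z f) (h₁ : ∀ u, 0 ≤ y₁ u) (h₂ : ∀ u, 0 ≤ y₂ u)
    (hflow : ∀ u, (∑ f ∈ F with f.1 = u, z f) - (∑ f ∈ F with f.2 = u, z f) = y₁ u - y₂ u)
    {u : V} (hu : 0 < y₁ u) :
    ∃ v, 0 < y₂ v ∧ Relation.ReflTransGen (fun a b => (a, b) ∈ F ∧ 0 < z (a, b)) u v := by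
  by_contra! hcon
  set X : Finset V := Finset.univ.filter
    (Relation.ReflTransGen (fun a b => (a, b) ∈ F ∧ 0 < z (a, b)) u)
  have hX : ∀ v ∈ X, y₂ v = 0 := fun v hv =>
    le_antisymm (not_lt.1 fun h => hcon v h (Finset.mem_filter.1 hv).2) (h₂ v)
  have h1 : ∑ v ∈ X, ((∑ f ∈ F with f.1 = v, z f) - (∑ f ∈ F with f.2 = v, z f)) =
      ∑ v ∈ X, y₁ v := Finset.sum_congr rfl fun v hv => by rw [hflow, hX v hv, sub_zero]
  have h2 : 0 < ∑ v ∈ X, y₁ v :=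
    Finset.sum_pos' (fun v _ => h₁ v) ⟨u, Finset.mem_filter.2 ⟨Finset.mem_univ _, .refl⟩, hu⟩
  rw [← h1, Finset.sum_sub_distrib, sum_sum_filter_eq, sum_sum_filter_eq,
    ← Finset.sum_sub_distrib] at h2
  refine absurd h2 (not_lt.2 (Finset.sum_nonpos fun f hf => ?_))
  by_cases hf2 : f.2 ∈ X
  · split_ifs
    · simp
    · simpa using hz f hf
  · have : (if f.1 ∈ X then z f else 0) = 0 := by
      split_ifs with hf1
      · refine le_antisymm (not_lt.1 fun h => hf2 ?_) (hz f hf)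
        exact Finset.mem_filter.2 ⟨Finset.mem_univ _, (Finset.mem_filter.1 hf1).2.tail ⟨hf, h⟩⟩
      · rfl
    simp [this, hf2]

/-- Flow decomposition: a nonnegative flow with supplies `y₁` and demands `y₂` contains weighted
paths that realize the supplies and demands. Cycles of the flow are dropped, whence the
inequality. -/
theorem exists_flowDecomposition (F : Finset (V × V)) (z : V × V → ℝ) (y₁ y₂ : V → ℝ)
    (hz : ∀ f ∈ F, 0 ≤ z f) (h₁ : ∀ u, 0 ≤ y₁ u) (h₂ : ∀ u, 0 ≤ y₂ u)
    (hflow : ∀ u, (∑ f ∈ F with f.1 = u, z f) - (∑ f ∈ F with f.2 = u, z f) = y₁ u - y₂ u) :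
    ∃ g : V × V × Finset (V × V) → ℝ, (∀ x, 0 ≤ g x) ∧
      (∀ x, g x ≠ 0 → IsEdgePath x.1 x.2.1 x.2.2 ∧ ∀ f ∈ x.2.2, f ∈ F ∧ 0 < z f) ∧
      (∀ u, ∑ x with x.1 = u, g x = y₁ u) ∧ (∀ v, ∑ x with x.2.1 = v, g x = y₂ v) ∧
      ∀ f ∈ F, ∑ x with f ∈ x.2.2, g x ≤ z f := by
  -- induction on the number of nonzero values
  induction hn : (Finset.univ.filter fun k => Sum.elim y₁ (Sum.elim y₂ z) k ≠ 0).card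
    using Nat.strong_induction_on generalizing z y₁ y₂ with
  | _ n ih =>
  by_cases hy : ∀ u, y₁ u = 0
  · have htot : ∑ v, y₂ v = 0 := by
      have h := Finset.sum_congr rfl fun u (_ : u ∈ Finset.univ) => hflow u
      rw [Finset.sum_sub_distrib, Finset.sum_sub_distrib, sum_sum_filter_eq, sum_sum_filter_eq] at h
      simpa [hy] using h
    have hy2 : ∀ v, y₂ v = 0 := fun v =>
      (Finset.sum_eq_zero_iff_of_nonneg fun v _ => h₂ v).1 htot v (Finset.mem_univ v)
    exact ⟨fun _ => 0, fun _ => le_rfl, fun _ h => absurd rfl h, fun u => by simp [hy],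
      fun v => by simp [hy2], fun f hf => by simpa using hz f hf⟩
  push Not at hy
  obtain ⟨u, hu⟩ := hy
  have hu : 0 < y₁ u := lt_of_le_of_ne (h₁ u) hu.symm
  obtain ⟨v, hv, hreach⟩ := exists_reachable_sink hz h₁ h₂ hflow hu
  obtain ⟨P, hP, hPz⟩ := exists_isEdgePath hreach
  have hPF : P ⊆ F := fun f hf => (hPz f hf).1
  have hPpos : ∀ f ∈ P, 0 < z f := fun f hf => (hPz f hf).2
  -- the largest amount that can be sent along `P`
  obtain ⟨δ, hδ, hδu, hδv, hδP, hδeq⟩ : ∃ δ, 0 < δ ∧ δ ≤ y₁ u ∧ δ ≤ y₂ v ∧ (∀ f ∈ P, δ ≤ z f) ∧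
      (δ = y₁ u ∨ δ = y₂ v ∨ ∃ f ∈ P, z f = δ) := by
    set T : Finset ℝ := insert (y₁ u) (insert (y₂ v) (P.image z)) with hT
    have hTn : T.Nonempty := ⟨_, Finset.mem_insert_self _ _⟩
    have hmem := T.min'_mem hTn
    refine ⟨T.min' hTn, ?_, T.min'_le _ (by simp [hT]), T.min'_le _ (by simp [hT]),
      fun f hf => T.min'_le _ ?_, ?_⟩
    · rw [Finset.lt_min'_iff]
      intro t ht
      simp only [hT, Finset.mem_insert, Finset.mem_image] at ht
      rcases ht with rfl | rfl | ⟨f, hf, rfl⟩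
      exacts [hu, hv, hPpos f hf]
    · simp only [hT, Finset.mem_insert, Finset.mem_image]
      exact .inr (.inr ⟨f, hf, rfl⟩)
    · simpa only [hT, Finset.mem_insert, Finset.mem_image] using hmem
  set z' : V × V → ℝ := fun f => z f - if f ∈ P then δ else 0 with hz'
  set y₁' : V → ℝ := fun x => y₁ x - if x = u then δ else 0 with hy₁'
  set y₂' : V → ℝ := fun x => y₂ x - if x = v then δ else 0 with hy₂'
  have hz'0 : ∀ f ∈ F, 0 ≤ z' f := by
    intro f hf
    simp only [hz']
    split_ifs with h
    · linarith [hδP f h]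
    · simpa using hz f hf
  have h₁'0 : ∀ x, 0 ≤ y₁' x := by
    intro x
    simp only [hy₁']
    split_ifs with h
    · subst h; linarith
    · simpa using h₁ x
  have h₂'0 : ∀ x, 0 ≤ y₂' x := by
    intro x
    simp only [hy₂']
    split_ifs with h
    · subst h; linarith
    · simpa using h₂ x
  have hflow' : ∀ x, (∑ f ∈ F with f.1 = x, z' f) - (∑ f ∈ F with f.2 = x, z' f) =
      y₁' x - y₂' x := by
    intro x
    have h1 := hP.flow hPF x
    have h2 := hflow x
    have h3 : ∀ p : V × V → Prop, ∑ f ∈ F with p f, z' f =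
        (∑ f ∈ F with p f, z f) - δ * ∑ f ∈ F with p f, if f ∈ P then (1 : ℝ) else 0 := by
      intro p
      rw [Finset.mul_sum, ← Finset.sum_sub_distrib]
      exact Finset.sum_congr rfl fun f _ => by simp [hz']
    have h4 : y₁' x = y₁ x - δ * if u = x then 1 else 0 := by simp [hy₁', eq_comm]
    have h5 : y₂' x = y₂ x - δ * if v = x then 1 else 0 := by simp [hy₂', eq_comm]
    rw [h3, h3, h4, h5]
    linear_combination h2 - δ * h1
  have hlt : (Finset.univ.filter fun k => Sum.elim y₁' (Sum.elim y₂' z') k ≠ 0).card < n := by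
    rw [← hn]
    refine Finset.card_lt_card (Finset.ssubset_iff_subset_ne.2 ⟨?_, ?_⟩)
    · rintro (x | x | f) hx <;> simp only [Finset.mem_filter, Finset.mem_univ, true_and,
        Sum.elim_inl, Sum.elim_inr, hy₁', hy₂', hz'] at hx ⊢ <;> intro h0 <;> apply hx <;>
        split_ifs with h
      · subst h; exact absurd h0 hu.ne'
      · simp [h0]
      · subst h; exact absurd h0 hv.ne'
      · simp [h0]
      · exact absurd h0 (hPpos f h).ne'
      · simp [h0]
    · intro heq
      rw [Finset.ext_iff] at heq
      simp only [Finset.mem_filter, Finset.mem_univ, true_and] at heq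
      rcases hδeq with h | h | ⟨f, hf, h⟩
      · exact (heq (.inl u)).2 hu.ne' (by simp [hy₁', h])
      · exact (heq (.inr (.inl v))).2 hv.ne' (by simp [hy₂', h])
      · exact (heq (.inr (.inr f))).2 (hPpos f hf).ne' (by simp [hz', hf, h])
  obtain ⟨g, hg0, hgP, hg1, hg2, hgz⟩ := ih _ hlt z' y₁' y₂' hz'0 h₁'0 h₂'0 hflow' rfl
  have hsum : ∀ (p : V × V × Finset (V × V) → Prop) [DecidablePred p],
      ∑ x with p x, (g x + if x = (u, v, P) then δ else 0) =
        (∑ x with p x, g x) + if p (u, v, P) then δ else 0 := by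
    intro p _
    rw [Finset.sum_add_distrib, Finset.sum_ite_eq']
    simp
  refine ⟨fun x => g x + if x = (u, v, P) then δ else 0, fun x => ?_, fun x hx => ?_,
    fun x => ?_, fun x => ?_, fun f hf => ?_⟩
  · have := hg0 x
    beta_reduce
    split_ifs <;> linarith
  · by_cases hx' : x = (u, v, P)
    · subst hx'
      exact ⟨hP, hPz⟩
    · obtain ⟨h1, h2⟩ := hgP x (by simpa [hx'] using hx)
      refine ⟨h1, fun f hf => ⟨(h2 f hf).1, (h2 f hf).2.trans_le ?_⟩⟩
      simp only [hz']
      split_ifs <;> linarith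
  · rw [hsum, hg1]
    simp [hy₁', eq_comm]
  · rw [hsum, hg2]
    simp [hy₂', eq_comm]
  · beta_reduce
    rw [hsum]
    have := hgz f hf
    simp only [hz'] at this
    linarith

end Flow

/-! ### Gluing weights on partial mappings -/

section Glue

/-- The image of a weight under a map. -/
def push {X Y : Type*} [Fintype X] (φ : X → Y) (g : X → ℝ) (t : Y) : ℝ :=
  ∑ x with φ x = t, g x

theorem push_nonneg {X Y : Type*} [Fintype X] {φ : X → Y} {g : X → ℝ} (hg : ∀ x, 0 ≤ g x)
    (t : Y) : 0 ≤ push φ g t := Finset.sum_nonneg fun x _ => hg x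

theorem sum_push_mul {X Y : Type*} [Fintype X] [Fintype Y] (φ : X → Y) (g : X → ℝ) (F : Y → ℝ) :
    ∑ t, push φ g t * F t = ∑ x, g x * F (φ x) := by
  rw [← Finset.sum_fiberwise (s := Finset.univ) (g := φ)]
  refine Finset.sum_congr rfl fun t _ => ?_
  rw [push, Finset.sum_mul]
  exact Finset.sum_congr rfl fun x hx => by rw [(Finset.mem_filter.1 hx).2]

theorem sum_push_filter {X Y : Type*} [Fintype X] [Fintype Y] (φ : X → Y) (g : X → ℝ)
    (p : Y → Prop) [DecidablePred p] : ∑ t with p t, push φ g t = ∑ x with p (φ x), g x := by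
  have := sum_push_mul φ g fun t => if p t then 1 else 0
  simpa [Finset.sum_filter] using this

theorem exists_of_push_ne_zero {X Y : Type*} [Fintype X] {φ : X → Y} {g : X → ℝ} {t : Y}
    (h : push φ g t ≠ 0) : ∃ x, φ x = t ∧ g x ≠ 0 := by
  obtain ⟨x, hx, h⟩ := Finset.exists_ne_zero_of_sum_ne_zero h
  exact ⟨x, (Finset.mem_filter.1 hx).2, h⟩

/-- Two weights with the same distribution of the key `I` are glued: a pair of elements with the
same key is chosen such that the elements are independent given the key, and is merged. The
result has the marginals of `μ` and of `ν`. -/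
theorem exists_glue {X K : Type*} [Fintype X] [DecidableEq K] {rμ rν : X → X → Prop} (I : X → K)
    (merge : X → X → X) (hμr : ∀ s s', I s = I s' → rμ (merge s s') s)
    (hνr : ∀ s s', I s = I s' → rν (merge s s') s') {μ ν : X → ℝ} (hμ : ∀ s, 0 ≤ μ s)
    (hν : ∀ s, 0 ≤ ν s) (hI : ∀ k, ∑ s with I s = k, μ s = ∑ s with I s = k, ν s) :
    ∃ l : X → ℝ, (∀ s, 0 ≤ l s) ∧
      (∀ (p : X → Prop) [DecidablePred p], (∀ s t, rμ s t → (p s ↔ p t)) →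
        ∑ s with p s, l s = ∑ s with p s, μ s) ∧
      ∀ (p : X → Prop) [DecidablePred p], (∀ s t, rν s t → (p s ↔ p t)) →
        ∑ s with p s, l s = ∑ s with p s, ν s := by
  set c : K → ℝ := fun k => ∑ s with I s = k, μ s with hc
  set J : X × X → ℝ := fun x => if I x.1 = I x.2 then μ x.1 * ν x.2 / c (I x.1) else 0 with hJ
  have hc0 : ∀ k, 0 ≤ c k := fun k => Finset.sum_nonneg fun s _ => hμ s
  have hfst : ∀ s, ∑ s', J (s, s') = μ s := by
    intro s
    have h1 : ∑ s', J (s, s') = μ s / c (I s) * ∑ s' with I s' = I s, ν s' := by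
      rw [Finset.mul_sum, Finset.sum_filter]
      refine Finset.sum_congr rfl fun s' _ => ?_
      simp only [hJ, eq_comm (a := I s)]
      split_ifs <;> ring
    rw [h1, ← hI]
    change μ s / c (I s) * c (I s) = μ s
    by_cases h : c (I s) = 0
    · have := (Finset.sum_eq_zero_iff_of_nonneg fun s _ => hμ s).1 h s (by simp)
      simp [this]
    · exact div_mul_cancel₀ _ h
  have hsnd : ∀ s', ∑ s, J (s, s') = ν s' := by
    intro s'
    have h1 : ∑ s, J (s, s') = ν s' / c (I s') * ∑ s with I s = I s', μ s := by
      rw [Finset.mul_sum, Finset.sum_filter]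
      refine Finset.sum_congr rfl fun s _ => ?_
      simp only [hJ]
      split_ifs with h
      · rw [h]; ring
      · rfl
    rw [h1]
    change ν s' / c (I s') * c (I s') = ν s'
    by_cases h : c (I s') = 0
    · have h' : ∑ s with I s = I s', ν s = 0 := (hI _).symm.trans h
      have := (Finset.sum_eq_zero_iff_of_nonneg fun s _ => hν s).1 h' s' (by simp)
      simp [this]
    · exact div_mul_cancel₀ _ h
  refine ⟨push (fun x : X × X => merge x.1 x.2) J, push_nonneg fun x => ?_, fun p _ hp => ?_,
    fun p _ hp => ?_⟩
  · simp only [hJ]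
    split_ifs
    exacts [div_nonneg (mul_nonneg (hμ _) (hν _)) (hc0 _), le_rfl]
  · rw [sum_push_filter, Finset.sum_filter, Fintype.sum_prod_type, Finset.sum_filter]
    refine Finset.sum_congr rfl fun s _ => ?_
    rw [← hfst s]
    have : ∀ s', (if p (merge s s') then J (s, s') else 0) = if p s then J (s, s') else 0 := by
      intro s'
      by_cases h : I s = I s'
      · simp only [hp _ _ (hμr s s' h)]
      · simp [hJ, h]
    simp only [this]
    split_ifs <;> simp
  · rw [sum_push_filter, Finset.sum_filter, Fintype.sum_prod_type_right, Finset.sum_filter]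
    refine Finset.sum_congr rfl fun s' _ => ?_
    rw [← hsnd s']
    have : ∀ s, (if p (merge s s') then J (s, s') else 0) = if p s' then J (s, s') else 0 := by
      intro s
      by_cases h : I s = I s'
      · simp only [hp _ _ (hνr s s' h)]
      · simp [hJ, h]
    simp only [this]
    split_ifs <;> simp

end Glue

/-! ### Weights on mappings that realize an LP solution -/

section Realize

variable {V T W : Type*} [Fintype V] [Fintype W] {S : Substrate V T}

/-- A node map together with a set of substrate edges for each virtual edge. Partial mappings are
represented by such total ones, of which only some coordinates are considered. -/
abbrev State (W V : Type*) := (W → V) × (W × W → Finset (V × V))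

/-- The weight `μ` realizes the node variables `y` on `N` and the flow variables `z` on `F`: it
has the marginals `y`, it selects allowed paths for the edges in `F`, and the expected usage of
the substrate edges by these paths is at most `z`. -/
structure Realizes (q : Request S W) (y : W → V → ℝ) (z : W × W → V × V → ℝ) (N : Finset W)
    (F : Finset (W × W)) (μ : State W V → ℝ) : Prop where
  nonneg : ∀ s, 0 ≤ μ s
  node : ∀ i ∈ N, ∀ u, ∑ s with s.1 i = u, μ s = y i u
  path : ∀ e ∈ F, ∀ s, μ s ≠ 0 → IsEdgePath (s.1 e.1) (s.1 e.2) (s.2 e) ∧ s.2 e ⊆ q.eloc e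
  usage : ∀ e ∈ F, ∀ f ∈ S.E, ∑ s with f ∈ s.2 e, μ s ≤ z e f

variable {q : Request S W} {y y' : W → V → ℝ} {z z' : W × W → V × V → ℝ} {N N' : Finset W}
  {F F' : Finset (W × W)} {μ ν : State W V → ℝ}

theorem Realizes.mono (h : Realizes q y z N F μ) (hN : N' ⊆ N) (hF : F' ⊆ F)
    (hy : ∀ i ∈ N', ∀ u, y i u = y' i u) (hz : ∀ e ∈ F', ∀ f ∈ S.E, z e f ≤ z' e f) :
    Realizes q y' z' N' F' μ :=
  ⟨h.nonneg, fun i hi u => (h.node i (hN hi) u).trans (hy i hi u), fun e he => h.path e (hF he),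
    fun e he f hf => (h.usage e (hF he) f hf).trans (hz e he f hf)⟩

theorem Realizes.sum {ι : Type*} {A : Finset ι} {y : ι → W → V → ℝ}
    {z : ι → W × W → V × V → ℝ} {μ : ι → State W V → ℝ}
    (h : ∀ w ∈ A, Realizes q (y w) (z w) N F (μ w)) :
    Realizes q (fun i u => ∑ w ∈ A, y w i u) (fun e f => ∑ w ∈ A, z w e f) N F
      (fun s => ∑ w ∈ A, μ w s) where
  nonneg s := Finset.sum_nonneg fun w hw => (h w hw).nonneg s
  node i hi u := by
    rw [Finset.sum_comm]
    exact Finset.sum_congr rfl fun w hw => (h w hw).node i hi u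
  path e he s hs := by
    obtain ⟨w, hw, h'⟩ := Finset.exists_ne_zero_of_sum_ne_zero hs
    exact (h w hw).path e he s h'
  usage e he f hf := by
    rw [Finset.sum_comm]
    exact Finset.sum_le_sum fun w hw => (h w hw).usage e he f hf

theorem Realizes.eq_zero_of_node (h : Realizes q y z N F μ) {i : W} (hi : i ∈ N) {s : State W V}
    (hs : y i (s.1 i) = 0) : μ s = 0 := by
  have h1 := h.node i hi (s.1 i)
  rw [hs] at h1
  exact (Finset.sum_eq_zero_iff_of_nonneg fun s _ => h.nonneg s).1 h1 s (by simp)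

/-- The weights of two realizations can be glued if they share a node `i`, and all other common
nodes have a fixed location. -/
theorem Realizes.glue (hμ : Realizes q y z N F μ) (hν : Realizes q y z N' F' ν)
    (hF : ∀ e ∈ F, e.1 ∈ N ∧ e.2 ∈ N) (hF' : ∀ e ∈ F', e.1 ∈ N' ∧ e.2 ∈ N')
    (hdisj : Disjoint F F') {i : W} (hi : i ∈ N) (hi' : i ∈ N')
    (hinter : ∀ j ∈ N, j ∈ N' → j = i ∨ ∃ w, ∀ u, u ≠ w → y j u = 0) :
    ∃ l, Realizes q y z (N ∪ N') (F ∪ F') l := by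
  set I : State W V → W → Option V := fun s j => if j ∈ N ∩ N' then some (s.1 j) else none with hI
  have hIeq : ∀ s t : State W V, I s = I t ↔ ∀ j ∈ N, j ∈ N' → s.1 j = t.1 j := by
    intro s t
    simp only [funext_iff, hI, Finset.mem_inter]
    refine forall_congr' fun j => ?_
    by_cases h1 : j ∈ N <;> by_cases h2 : j ∈ N' <;> simp [h1, h2]
  -- the distribution of the common coordinates is determined by the location of `i`
  have hkey : ∀ {M : Finset W} {G : Finset (W × W)} {κ : State W V → ℝ}, Realizes q y z M G κ →
      N ∩ N' ⊆ M → ∀ t : State W V, ∑ s with I s = I t, κ s =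
        if ∃ j ∈ N ∩ N', y j (t.1 j) = 0 then 0 else y i (t.1 i) := by
    intro M G κ hκ hM t
    split_ifs with h
    · obtain ⟨j, hj, h⟩ := h
      refine Finset.sum_eq_zero fun s hs => hκ.eq_zero_of_node (hM hj) ?_
      rw [(hIeq s t).1 (Finset.mem_filter.1 hs).2 j (Finset.mem_inter.1 hj).1
        (Finset.mem_inter.1 hj).2, h]
    · push Not at h
      rw [← hκ.node i (hM (Finset.mem_inter.2 ⟨hi, hi'⟩)), Finset.sum_filter, Finset.sum_filter]
      refine Finset.sum_congr rfl fun s _ => ?_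
      by_cases hs : κ s = 0
      · simp [hs]
      refine if_congr ?_ rfl rfl
      rw [hIeq]
      refine ⟨fun h => h i hi hi', fun hsi j hj hj' => ?_⟩
      rcases hinter j hj hj' with rfl | ⟨w, hw⟩
      · exact hsi
      have hjj := Finset.mem_inter.2 ⟨hj, hj'⟩
      have h1 : s.1 j = w := by
        by_contra h'
        exact hs (hκ.eq_zero_of_node (hM hjj) (hw _ h'))
      have h2 : t.1 j = w := by
        by_contra h'
        exact h j hjj (hw _ h')
      rw [h1, h2]
  obtain ⟨l, hl0, hl, hl'⟩ := exists_glue (μ := μ) (ν := ν) I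
    (merge := fun s s' => (fun j => if j ∈ N then s.1 j else s'.1 j,
      fun e => if e ∈ F then s.2 e else s'.2 e))
    (rμ := fun s t => (∀ j ∈ N, s.1 j = t.1 j) ∧ ∀ e ∈ F, s.2 e = t.2 e)
    (rν := fun s t => (∀ j ∈ N', s.1 j = t.1 j) ∧ ∀ e ∈ F', s.2 e = t.2 e)
    (fun s s' _ => ⟨fun j hj => by simp [hj], fun e he => by simp [he]⟩)
    (fun s s' h => ⟨fun j hj => by
        by_cases hj' : j ∈ N
        · simpa [hj'] using (hIeq s s').1 h j hj' hj
        · simp [hj'], fun e he => by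
        have : e ∉ F := fun h => Finset.disjoint_left.1 hdisj h he
        simp [this]⟩)
    hμ.nonneg hν.nonneg (fun k => by
      by_cases hk : ∃ t, I t = k
      · obtain ⟨t, rfl⟩ := hk
        rw [hkey hμ Finset.inter_subset_left, hkey hν Finset.inter_subset_right]
      · push Not at hk
        simp [hk])
  -- properties of the glued weight that hold almost surely are inherited
  have hsupp : ∀ {κ : State W V → ℝ} (p : State W V → Prop) [DecidablePred p],
      (∑ s with p s, l s = ∑ s with p s, κ s) → (∀ s, p s → κ s = 0) → ∀ s, p s → l s = 0 := by
    intro κ p _ h h0 s hs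
    rw [Finset.sum_eq_zero (s := Finset.univ.filter p) (f := κ)
      fun s hs => h0 s (Finset.mem_filter.1 hs).2] at h
    exact (Finset.sum_eq_zero_iff_of_nonneg fun s _ => hl0 s).1 h s (by simp [hs])
  refine ⟨l, hl0, fun j hj u => ?_, fun e he s hs => ?_, fun e he f hf => ?_⟩
  · rcases Finset.mem_union.1 hj with hj | hj
    · rw [hl _ fun s t h => by rw [h.1 j hj]]
      exact hμ.node j hj u
    · rw [hl' _ fun s t h => by rw [h.1 j hj]]
      exact hν.node j hj u
  · by_contra hcon
    rcases Finset.mem_union.1 he with he | he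
    · exact hs (hsupp (κ := μ)
        (fun s => ¬(IsEdgePath (s.1 e.1) (s.1 e.2) (s.2 e) ∧ s.2 e ⊆ q.eloc e))
        (hl _ fun s t h => by rw [h.1 _ (hF e he).1, h.1 _ (hF e he).2, h.2 e he])
        (fun s h => by_contra fun h' => h (hμ.path e he s h')) s hcon)
    · exact hs (hsupp (κ := ν)
        (fun s => ¬(IsEdgePath (s.1 e.1) (s.1 e.2) (s.2 e) ∧ s.2 e ⊆ q.eloc e))
        (hl' _ fun s t h => by rw [h.1 _ (hF' e he).1, h.1 _ (hF' e he).2, h.2 e he])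
        (fun s h => by_contra fun h' => h (hν.path e he s h')) s hcon)
  · rcases Finset.mem_union.1 he with he | he
    · rw [hl _ fun s t h => by rw [h.2 e he]]
      exact hμ.usage e he f hf
    · rw [hl' _ fun s t h => by rw [h.2 e he]]
      exact hν.usage e he f hf

theorem exists_realizes_singleton (q : Request S W) (z : W × W → V × V → ℝ) {i : W}
    (hy : ∀ u, 0 ≤ y i u) : ∃ μ, Realizes q y z {i} ∅ μ := by
  refine ⟨push (fun u => ((fun _ => u, fun _ => ∅) : State W V)) (y i), push_nonneg hy, ?_,
    fun e he => absurd he (Finset.notMem_empty e), fun e he => absurd he (Finset.notMem_empty e)⟩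
  intro j hj u
  rw [Finset.mem_singleton.1 hj, sum_push_filter]
  simp [Finset.sum_filter]

/-- The flow variables of a single edge are realized by a path decomposition. -/
theorem exists_realizes_edge {e : W × W} (hne : e.1 ≠ e.2) (hy₁ : ∀ u, 0 ≤ y e.1 u)
    (hy₂ : ∀ u, 0 ≤ y e.2 u) (hz : ∀ f ∈ S.E, 0 ≤ z e f)
    (hz0 : ∀ f ∈ S.E \ q.eloc e, z e f = 0)
    (hflow : ∀ u, (∑ f ∈ S.E with f.1 = u, z e f) - (∑ f ∈ S.E with f.2 = u, z e f) =
      y e.1 u - y e.2 u) :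
    ∃ μ, Realizes q y z (verts {e}) {e} μ := by
  obtain ⟨g, hg0, hg, hg1, hg2, hgz⟩ := exists_flowDecomposition S.E _ _ _ hz hy₁ hy₂ hflow
  refine ⟨push (fun x => (fun k => if k = e.1 then x.1 else x.2.1, fun _ => x.2.2)) g,
    push_nonneg hg0, fun i hi u => ?_, fun e' he' s hs => ?_, fun e' he' f hf => ?_⟩
  · rw [sum_push_filter]
    have : i = e.1 ∨ i = e.2 := by simpa [verts] using hi
    rcases this with rfl | rfl
    · simpa using hg1 u
    · simpa [hne.symm] using hg2 u
  · obtain ⟨x, rfl, hx⟩ := exists_of_push_ne_zero hs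
    rw [Finset.mem_singleton.1 he']
    refine ⟨by simpa [hne.symm] using (hg x hx).1, fun f hf => ?_⟩
    obtain ⟨h1, h2⟩ := (hg x hx).2 f hf
    by_contra h
    exact h2.ne' (hz0 f (Finset.mem_sdiff.2 ⟨h1, h⟩))
  · rw [Finset.mem_singleton.1 he', sum_push_filter]
    exact hgz f hf

/-- If the location of one of its nodes is fixed, then a cycle is realized by gluing its edges
one after the other, starting and ending at that node. -/
theorem exists_realizes_cycle {E C : Finset (W × W)} (hC : IsCycle E C) {t : W}
    (ht : t ∈ verts C) {w : V} (hw : ∀ u, u ≠ w → y t u = 0) (hyt : ∀ u, 0 ≤ y t u)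
    (hedge : ∀ e ∈ C, ∃ μ, Realizes q y z (verts {e}) {e} μ) :
    ∃ μ, Realizes q y z (verts C) C μ := by
  obtain ⟨L, r, g, hr, hg, h0, hL, hrg, rfl⟩ := hC.exists_seq ht
  have hv : ∀ k < L, verts {g k} = {r k, r (k + 1)} := by
    intro k hk
    ext x
    rcases (hrg k hk).2 with h | h <;> simp [verts, h, or_comm]
  have key : ∀ k ≤ L, ∃ μ, Realizes q y z ((Finset.range (k + 1)).image r)
      ((Finset.range k).image g) μ := by
    intro k
    induction k with
    | zero =>
      intro _
      obtain ⟨μ, hμ⟩ := exists_realizes_singleton q z hyt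
      exact ⟨μ, by simpa [h0] using hμ⟩
    | succ k ih =>
      intro hk
      obtain ⟨μ, hμ⟩ := ih (by omega)
      obtain ⟨ν, hν⟩ := hedge (g k) (Finset.mem_image_of_mem g (Finset.mem_range.2 hk))
      rw [hv k hk] at hν
      have hmem : ∀ j ≤ k, r j ∈ (Finset.range (k + 1)).image r := fun j hj =>
        Finset.mem_image_of_mem r (Finset.mem_range.2 (by omega))
      have hend : ∀ e ∈ (Finset.range k).image g, e.1 ∈ (Finset.range (k + 1)).image r ∧
          e.2 ∈ (Finset.range (k + 1)).image r := by
        intro e he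
        obtain ⟨a, ha, rfl⟩ := Finset.mem_image.1 he
        rw [Finset.mem_range] at ha
        have h1 := hmem a ha.le
        have h2 := hmem (a + 1) ha
        rcases (hrg a (by omega)).2 with h | h <;> rw [h]
        exacts [⟨h1, h2⟩, ⟨h2, h1⟩]
      have hend' : ∀ e ∈ ({g k} : Finset (W × W)), e.1 ∈ ({r k, r (k + 1)} : Finset W) ∧
          e.2 ∈ ({r k, r (k + 1)} : Finset W) := by
        intro e he
        rw [← hv k hk]
        exact ⟨fst_mem_verts he, snd_mem_verts he⟩
      have hdisj : Disjoint ((Finset.range k).image g) {g k} := by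
        rw [Finset.disjoint_singleton_right]
        intro h
        obtain ⟨a, ha, h⟩ := Finset.mem_image.1 h
        rw [Finset.mem_range] at ha
        exact ha.ne (hg (Set.mem_Iio.2 (by omega)) (Set.mem_Iio.2 hk) h)
      have hinter : ∀ j ∈ (Finset.range (k + 1)).image r, j ∈ ({r k, r (k + 1)} : Finset W) →
          j = r k ∨ ∃ w, ∀ u, u ≠ w → y j u = 0 := by
        intro j hj hj'
        rcases Finset.mem_insert.1 hj' with rfl | hj'
        · exact .inl rfl
        rw [Finset.mem_singleton] at hj'
        subst hj'
        obtain ⟨a, ha, h⟩ := Finset.mem_image.1 hj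
        rw [Finset.mem_range] at ha
        rcases Nat.eq_or_lt_of_le hk with h' | h'
        · -- the last edge returns to the fixed node
          rw [h', hL]
          exact .inr ⟨w, hw⟩
        · have := hr (Set.mem_Iio.2 (by omega)) (Set.mem_Iio.2 h') h
          omega
      obtain ⟨l, hl⟩ := hμ.glue hν hend hend' hdisj (hmem k le_rfl) (by simp) hinter
      refine ⟨l, hl.mono ?_ ?_ (fun _ _ _ => rfl) fun _ _ _ _ => le_rfl⟩
      · rw [Finset.range_add_one, Finset.image_insert, Finset.insert_subset_iff]
        exact ⟨Finset.mem_union_right _ (by simp), Finset.subset_union_left⟩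
      · rw [Finset.range_add_one, Finset.image_insert, Finset.insert_subset_iff]
        exact ⟨Finset.mem_union_right _ (by simp), Finset.subset_union_left⟩
  obtain ⟨μ, hμ⟩ := key L le_rfl
  refine ⟨μ, hμ.mono (fun x hx => ?_) subset_rfl (fun _ _ _ => rfl) fun _ _ _ _ => le_rfl⟩
  obtain ⟨e, he, hx⟩ := mem_verts.1 hx
  obtain ⟨k, hk, rfl⟩ := Finset.mem_image.1 he
  have hk' := Finset.mem_range.1 hk
  have : x ∈ verts {g k} := mem_verts.2 ⟨g k, by simp, hx⟩
  rw [hv k hk', Finset.mem_insert, Finset.mem_singleton] at this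
  rcases this with rfl | rfl
  exacts [Finset.mem_image_of_mem r (Finset.mem_range.2 (by omega)),
    Finset.mem_image_of_mem r (Finset.mem_range.2 (by omega))]

/-- Realizations of the blocks of a cactus graph are glued one after the other: each further
block shares exactly one node with the connected part that has been covered. -/
theorem exists_realizes_cactus (hE : IsCactus q.E) (hy : ∀ i u, 0 ≤ y i u)
    (hblock : ∀ B ∈ blocks q.E, ∃ μ, Realizes q y z (verts B) B μ) :
    ∃ μ, Realizes q y z Finset.univ q.E μ := by
  obtain ⟨root⟩ := hE.nonempty
  -- the collections of blocks that have been covered, together with their connected node sets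
  set Cov : Finset (Finset (W × W)) → Prop := fun 𝔅 => 𝔅 ⊆ blocks q.E ∧ ∃ N : Finset W,
    root ∈ N ∧ (∀ B ∈ 𝔅, verts B ⊆ N) ∧
    (∀ i ∈ N, Relation.ReflTransGen (Adj (𝔅.biUnion id)) root i) ∧
    ∃ μ, Realizes q y z N (𝔅.biUnion id) μ with hCov
  have hne : (Finset.univ.filter Cov).Nonempty := by
    obtain ⟨μ, hμ⟩ := exists_realizes_singleton q z (hy root)
    refine ⟨∅, Finset.mem_filter.2 ⟨Finset.mem_univ _, Finset.empty_subset _, {root},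
      Finset.mem_singleton_self _, by simp, fun i hi => ?_, μ, by simpa using hμ⟩⟩
    rw [Finset.mem_singleton.1 hi]
  obtain ⟨𝔅, h𝔅, hmax⟩ := Finset.exists_max_image _ Finset.card hne
  obtain ⟨hsub, N, hroot, hverts, hconn, μ, hμ⟩ := (Finset.mem_filter.1 h𝔅).2
  have hconn' : ∀ i ∈ N, ∀ j ∈ N, Relation.ReflTransGen (Adj (𝔅.biUnion id)) i j :=
    fun i hi j hj => (conn_symm (hconn i hi)).trans (hconn j hj)
  have hFN : ∀ e ∈ 𝔅.biUnion id, e.1 ∈ N ∧ e.2 ∈ N := by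
    intro e he
    obtain ⟨B, hB, he⟩ := Finset.mem_biUnion.1 he
    exact ⟨hverts B hB (fst_mem_verts he), hverts B hB (snd_mem_verts he)⟩
  have hnew : ∀ B ∈ blocks q.E, ∀ i ∈ verts B, i ∈ N → B ∈ 𝔅 := by
    intro B hB i hiB hiN
    by_contra hB𝔅
    have hout : ∀ e ∈ 𝔅.biUnion id, e ∉ B := by
      intro e he heB
      obtain ⟨B', hB', he⟩ := Finset.mem_biUnion.1 he
      exact hB𝔅 (hE.blocks_disjoint (hsub hB') hB he heB ▸ hB')
    have hsd : 𝔅.biUnion id ⊆ q.E \ B := by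
      intro e he
      refine Finset.mem_sdiff.2 ⟨?_, hout e he⟩
      obtain ⟨B', hB', he⟩ := Finset.mem_biUnion.1 he
      exact subset_of_mem_blocks (hsub hB') he
    obtain ⟨ν, hν⟩ := hblock B hB
    obtain ⟨l, hl⟩ := hμ.glue hν hFN (fun e he => ⟨fst_mem_verts he, snd_mem_verts he⟩)
      (Finset.disjoint_left.2 hout) hiN hiB (fun j hj hjB => .inl (by
        by_contra hji
        exact hE.not_conn_sdiff_block hB hjB hiB hji
          (conn_mono hsd (hconn' j hj i hiN))))
    have hcov : Cov (insert B 𝔅) := by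
      refine ⟨Finset.insert_subset hB hsub, N ∪ verts B, Finset.mem_union_left _ hroot, ?_, ?_,
        l, ?_⟩
      · intro B' hB'
        rcases Finset.mem_insert.1 hB' with rfl | hB'
        exacts [Finset.subset_union_right, (hverts B' hB').trans Finset.subset_union_left]
      · have h1 : 𝔅.biUnion id ⊆ (insert B 𝔅).biUnion id :=
          Finset.biUnion_subset_biUnion_of_subset_left _ (Finset.subset_insert _ _)
        have h2 : B ⊆ (insert B 𝔅).biUnion id :=
          Finset.subset_biUnion_of_mem id (Finset.mem_insert_self B 𝔅)
        intro j hj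
        rcases Finset.mem_union.1 hj with hj | hj
        · exact conn_mono h1 (hconn j hj)
        · exact (conn_mono h1 (hconn i hiN)).trans (conn_mono h2 (block_conn hB hiB hj))
      · rwa [Finset.biUnion_insert, id, Finset.union_comm B]
    have := hmax _ (Finset.mem_filter.2 ⟨Finset.mem_univ _, hcov⟩)
    rw [Finset.card_insert_of_notMem hB𝔅] at this
    omega
  have hN : ∀ i, i ∈ N := by
    intro i
    have h : Relation.ReflTransGen (Adj q.E) root i := hE.connected root i
    induction h with
    | refl => exact hroot
    | tail _ h ih =>
      obtain ⟨e, he, h⟩ := h.exists_edge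
      obtain ⟨B, hB, heB⟩ := exists_block he
      rcases h with rfl | rfl
      · exact hverts B (hnew B hB _ (fst_mem_verts heB) ih) (snd_mem_verts heB)
      · exact hverts B (hnew B hB _ (snd_mem_verts heB) ih) (fst_mem_verts heB)
  refine ⟨μ, hμ.mono (fun i _ => hN i) (fun e he => ?_) (fun _ _ _ => rfl) fun _ _ _ _ => le_rfl⟩
  obtain ⟨B, hB, heB⟩ := exists_block he
  exact Finset.mem_biUnion.2 ⟨B, hnew B hB _ (fst_mem_verts heB) (hN _), heB⟩

end Realize

/-! ### Decomposition of LP solutions -/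

section Decomposition

variable {V T W : Type*} [Fintype V] [Fintype T] {S : Substrate V T}

theorem mem_resources {ρ : Res V T} : ρ ∈ S.resources ↔
    (∃ τ, ∃ u ∈ S.host τ, ρ = Sum.inl (τ, u)) ∨ ∃ f ∈ S.E, ρ = Sum.inr f := by
  simp only [Substrate.resources, Substrate.nodeRes, Substrate.edgeRes, Finset.mem_union,
    Finset.mem_filter, Finset.mem_univ, true_and]

theorem cap_pos {ρ : Res V T} (h : ρ ∈ S.resources) : 0 < S.cap ρ := by
  rcases mem_resources.1 h with ⟨τ, u, hu, rfl⟩ | ⟨f, hf, rfl⟩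
  exacts [S.node_cap_pos τ u hu, S.edge_cap_pos f hf]

variable {q : Request S W} {N : Finset W} {F : Finset (W × W)}

theorem MCFVars.Feasible.y_eq_zero {c : MCFVars W V T} (hc : c.Feasible q N F) {i : W}
    (hi : i ∈ N) {u : V} (hu : u ∉ q.loc i) : c.y i u = 0 :=
  (Finset.sum_eq_zero_iff_of_nonneg fun u _ => (hc.y_mem i hi u).1).1 (hc.node_forbidden i hi) u
    (Finset.mem_compl.2 hu)

variable [Fintype W]

theorem MCFVars.Feasible.exists_realizes_edge {c : MCFVars W V T} (hc : c.Feasible q N F)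
    {e : W × W} (he : e ∈ F) (h₁ : e.1 ∈ N) (h₂ : e.2 ∈ N) (hne : e.1 ≠ e.2) :
    ∃ μ, Realizes q c.y c.z (verts {e}) {e} μ :=
  VNEP.exists_realizes_edge hne (fun u => (hc.y_mem _ h₁ u).1) (fun u => (hc.y_mem _ h₂ u).1)
    (fun f hf => (hc.z_mem e he f hf).1) (hc.edge_forbidden e he) (hc.flow e he)

/-- The total flow for an edge `e`, summed over all copies of its flow variables. In a cactus
graph `e` lies either on the forest or on exactly one cycle. -/
def LPVars.totalFlow (q : Request S W) (o : Reorientation q.E) (v : LPVars W V T) (e : W × W)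
    (f : V × V) : ℝ :=
  (if e ∈ forestEdges q.E then v.forest.z e f else 0) +
    ∑ C ∈ cycles q.E with e ∈ C, ∑ w ∈ q.loc (target o C), (v.cyc C w).z e f

/-- Each block of the request is realized: a cycle is realized separately for each location of
its target, and an edge of the forest by a flow decomposition. Hence so is the whole request. -/
theorem LPVars.Feasible.exists_realizes (hE : IsCactus q.E) {o : Reorientation q.E}
    {v : LPVars W V T} (h : v.Feasible q o) :
    ∃ μ, Realizes q (fun i u => if u ∈ q.loc i then v.y i u else 0) (v.totalFlow q o)
      Finset.univ q.E μ := by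
  have hcyc0 : ∀ C ∈ cycles q.E, ∀ e ∈ C, ∀ f ∈ S.E,
      0 ≤ ∑ w ∈ q.loc (target o C), (v.cyc C w).z e f := fun C hC e he f hf =>
    Finset.sum_nonneg fun w hw => ((h.cycle_lp C hC w hw).z_mem e he f hf).1
  refine exists_realizes_cactus hE (fun i u => ?_) fun B hB => ?_
  · split_ifs
    exacts [(h.y_mem i u).1, le_rfl]
  rcases Finset.mem_union.1 hB with hC | hB
  · have hex : ∀ w, ∃ μ, w ∈ q.loc (target o B) →
        Realizes q (v.cyc B w).y (v.cyc B w).z (verts B) B μ := by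
      intro w
      by_cases hw : w ∈ q.loc (target o B)
      · have hc := h.cycle_lp B hC w hw
        have ht := target_mem_verts o hC
        obtain ⟨μ, hμ⟩ := exists_realizes_cycle (q := q) (y := (v.cyc B w).y)
          (z := (v.cyc B w).z) (isCycle_of_mem_cycles hC) ht (w := w)
          (fun u hu => by
            by_cases hu' : u ∈ q.loc (target o B)
            · exact h.node_target B hC w hw u (by simp [hu, hu'])
            · exact hc.y_eq_zero ht hu')
          (fun u => (hc.y_mem _ ht u).1)
          (fun e he => hc.exists_realizes_edge he (fst_mem_verts he) (snd_mem_verts he)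
            (hE.fst_ne_snd (subset_of_mem_cycles hC he)))
        exact ⟨μ, fun _ => hμ⟩
      · exact ⟨fun _ => 0, fun h => absurd h hw⟩
    choose μ hμ using hex
    refine ⟨_, (Realizes.sum (A := q.loc (target o B)) hμ).mono subset_rfl subset_rfl
      (fun i hi u => ?_) fun e he f hf => ?_⟩
    · split_ifs with hu
      · exact (h.node_cycle B hC i hi u hu).symm
      · exact Finset.sum_eq_zero fun w hw => (h.cycle_lp B hC w hw).y_eq_zero hi hu
    · have h1 := Finset.single_le_sum (s := (cycles q.E).filter (e ∈ ·))
        (f := fun C => ∑ w ∈ q.loc (target o C), (v.cyc C w).z e f)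
        (fun C hC => hcyc0 C (Finset.mem_filter.1 hC).1 e (Finset.mem_filter.1 hC).2 f hf)
        (Finset.mem_filter.2 ⟨hC, he⟩)
      refine h1.trans (le_add_of_nonneg_left ?_)
      split_ifs with h2
      exacts [(h.forest_lp.z_mem e h2 f hf).1, le_rfl]
  · obtain ⟨e, he, rfl⟩ := Finset.mem_image.1 hB
    have heE : e ∈ q.E := (Finset.mem_filter.1 he).1
    obtain ⟨μ, hμ⟩ := h.forest_lp.exists_realizes_edge he (Finset.mem_univ _)
      (Finset.mem_univ _) (hE.fst_ne_snd heE)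
    refine ⟨μ, hμ.mono subset_rfl subset_rfl (fun i hi u => ?_) fun e' he' f hf => ?_⟩
    · split_ifs with hu
      · exact (h.node_forest i u hu).symm
      · exact h.forest_lp.y_eq_zero (Finset.mem_univ i) hu
    · rw [Finset.mem_singleton.1 he', LPVars.totalFlow, if_pos he]
      exact le_add_of_nonneg_right (Finset.sum_nonneg fun C hC =>
        hcyc0 C (Finset.mem_filter.1 hC).1 e (Finset.mem_filter.1 hC).2 f hf)

/-- Every feasible solution of the novel LP is a convex combination of valid mappings. -/
theorem LPVars.Feasible.exists_isDecomposition (hE : IsCactus q.E) {o : Reorientation q.E}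
    {v : LPVars W V T} (h : v.Feasible q o) : ∃ D : ConvexComb q, IsDecomposition v D := by
  obtain ⟨μ, hμ⟩ := h.exists_realizes hE
  set toMap : State W V → (W → V) × (q.E → Finset (V × V)) := fun s => (s.1, fun e => s.2 e)
  have hvalid : ∀ s, μ s ≠ 0 → IsValid q (toMap s) := by
    refine fun s hs => ⟨fun i => ?_, fun e => hμ.path e e.2 s hs⟩
    by_contra hi
    exact hs (hμ.eq_zero_of_node (Finset.mem_univ i) (if_neg hi))
  have hsum : ∀ G : (W → V) × (q.E → Finset (V × V)) → ℝ,
      ∑ m : ValidMapping q, push toMap μ m.1 * G m.1 = ∑ s, μ s * G (toMap s) := by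
    intro G
    rw [← sum_push_mul toMap μ G, ← Finset.sum_subtype (Finset.univ.filter (IsValid q))
      (p := IsValid q) (fun x => by simp) fun x => push toMap μ x * G x]
    refine Finset.sum_subset (Finset.subset_univ _) fun x _ hx => ?_
    have : push toMap μ x = 0 := by
      by_contra hne
      obtain ⟨s, rfl, hs⟩ := exists_of_push_ne_zero hne
      exact hx (Finset.mem_filter.2 ⟨Finset.mem_univ _, hvalid s hs⟩)
    rw [this, zero_mul]
  have htot : ∑ m : ValidMapping q, push toMap μ m.1 = v.x := by
    obtain ⟨i⟩ := hE.nonempty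
    have h1 := hsum fun _ => 1
    simp only [mul_one] at h1
    rw [h1, ← Finset.sum_fiberwise (s := Finset.univ) (g := fun s : State W V => s.1 i), h.node i]
    simp only [hμ.node i (Finset.mem_univ i)]
    simp
  set weight : ValidMapping q → ℝ≥0 := fun m => ⟨push toMap μ m.1, push_nonneg hμ.nonneg _⟩
  have hle : ∑ m, weight m ≤ 1 := by
    rw [← NNReal.coe_le_coe, NNReal.coe_sum]
    exact htot.le.trans h.x_mem.2
  refine ⟨⟨weight, hle⟩, htot, fun ρ hρ => ?_⟩
  rcases mem_resources.1 hρ with ⟨τ, u, hu, rfl⟩ | ⟨f, hf, rfl⟩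
  · refine (hsum fun x => ∑ i with q.type i = τ ∧ x.1 i = u, q.nodeDemand i).trans_le ?_
    rw [h.load_node τ u hu]
    have h1 : ∀ s : State W V, μ s * ∑ i with q.type i = τ ∧ (toMap s).1 i = u, q.nodeDemand i =
        ∑ i with q.type i = τ, q.nodeDemand i * if s.1 i = u then μ s else 0 := by
      intro s
      rw [Finset.mul_sum, ← Finset.filter_filter, Finset.sum_filter (p := fun i => _ = u)]
      refine Finset.sum_congr rfl fun i _ => ?_
      simp only [toMap]
      split_ifs <;> ring
    rw [Finset.sum_congr rfl fun s _ => h1 s, Finset.sum_comm]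
    refine Finset.sum_le_sum fun i _ => ?_
    rw [← Finset.mul_sum, ← Finset.sum_filter, hμ.node i (Finset.mem_univ i)]
    refine mul_le_mul_of_nonneg_left ?_ (q.nodeDemand_nonneg i)
    split_ifs
    exacts [le_rfl, (h.y_mem i u).1]
  · refine (hsum fun x => ∑ e : q.E with f ∈ x.2 e, q.edgeDemand e.1).trans_le ?_
    have h1 : ∀ s : State W V, μ s * ∑ e : q.E with f ∈ (toMap s).2 e, q.edgeDemand e.1 =
        ∑ e : q.E, q.edgeDemand e.1 * if f ∈ s.2 e.1 then μ s else 0 := by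
      intro s
      rw [Finset.mul_sum, Finset.sum_filter]
      refine Finset.sum_congr rfl fun i _ => ?_
      simp only [toMap]
      split_ifs <;> ring
    rw [Finset.sum_congr rfl fun s _ => h1 s, Finset.sum_comm]
    have h2 : ∑ e : q.E, ∑ s : State W V, (q.edgeDemand e.1 * if f ∈ s.2 e.1 then μ s else 0) ≤
        ∑ e : q.E, q.edgeDemand e.1 * v.totalFlow q o e.1 f := by
      refine Finset.sum_le_sum fun e _ => ?_
      rw [← Finset.mul_sum, ← Finset.sum_filter]
      exact mul_le_mul_of_nonneg_left (hμ.usage e e.2 f hf) (q.edgeDemand_nonneg e e.2)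
    refine h2.trans_eq ?_
    rw [Finset.sum_coe_sort q.E fun e => q.edgeDemand e * v.totalFlow q o e f, h.load_edge f hf,
      ← h.forest_lp.load_edge f hf]
    simp only [LPVars.totalFlow, mul_add, Finset.sum_add_distrib]
    congr 1
    · rw [forestEdges, Finset.sum_filter]
      refine Finset.sum_congr rfl fun e he => ?_
      simp only [Finset.mem_filter, he, true_and]
      split_ifs <;> simp
    · have h3 : ∀ C ∈ cycles q.E, ∑ w ∈ q.loc (target o C), (v.cyc C w).a (Sum.inr f) =
          ∑ e ∈ q.E, if e ∈ C then
            q.edgeDemand e * ∑ w ∈ q.loc (target o C), (v.cyc C w).z e f else 0 := by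
        intro C hC
        rw [← Finset.sum_filter, Finset.filter_mem_eq_inter,
          Finset.inter_eq_right.2 (subset_of_mem_cycles hC)]
        simp only [Finset.mul_sum]
        rw [Finset.sum_comm]
        exact Finset.sum_congr rfl fun w hw => ((h.cycle_lp C hC w hw).load_edge f hf).symm
      rw [Finset.sum_congr rfl h3, Finset.sum_comm]
      refine Finset.sum_congr rfl fun e _ => ?_
      rw [Finset.mul_sum, Finset.sum_filter]

end Decomposition

/-! ### LP solutions from convex combinations, and optimal LP solutions -/

section Compose

theorem alloc_nonneg {V T W : Type*} [Fintype W] {S : Substrate V T} {q : Request S W}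
    (m : ValidMapping q) (ρ : Res V T) : 0 ≤ alloc m ρ := by
  rcases ρ with ⟨τ, u⟩ | f
  · exact Finset.sum_nonneg fun i _ => q.nodeDemand_nonneg i
  · exact Finset.sum_nonneg fun e _ => q.edgeDemand_nonneg e e.2

variable {V T W : Type*} [Fintype V] [Fintype T] [Fintype W] {S : Substrate V T}

/-- The solution of the multi-commodity flow formulation that is induced by weights `g` on the
valid mappings. The flow variables of pairs that are no edges of the request are set to `0`. -/
def mcfOf (q : Request S W) (g : ValidMapping q → ℝ) (N : Finset W) (F : Finset (W × W)) :
    MCFVars W V T where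
  x := ∑ m, g m
  y i u := ∑ m with m.1.1 i = u, g m
  z e f := if h : e ∈ q.E then ∑ m with f ∈ m.1.2 ⟨e, h⟩, g m else 0
  a := Sum.elim
    (fun x => ∑ i ∈ N with q.type i = x.1, q.nodeDemand i * ∑ m with m.1.1 i = x.2, g m)
    (fun f => ∑ e ∈ F, q.edgeDemand e *
      if h : e ∈ q.E then ∑ m with f ∈ m.1.2 ⟨e, h⟩, g m else 0)

variable {q : Request S W} {g : ValidMapping q → ℝ} {N : Finset W} {F : Finset (W × W)}

theorem mcfOf_feasible (hg : ∀ m, 0 ≤ g m) (hg1 : ∑ m, g m ≤ 1) (hF : F ⊆ q.E) :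
    (mcfOf q g N F).Feasible q N F := by
  have hsub : ∀ (p : ValidMapping q → Prop) [DecidablePred p],
      ∑ m with p m, g m ∈ Set.Icc (0 : ℝ) 1 := fun p _ =>
    ⟨Finset.sum_nonneg fun m _ => hg m, (Finset.sum_le_sum_of_subset_of_nonneg
      (Finset.filter_subset _ _) fun m _ _ => hg m).trans hg1⟩
  have hy : ∀ i u, (mcfOf q g N F).y i u ∈ Set.Icc (0 : ℝ) 1 := fun i u => hsub _
  have hz : ∀ e f, (mcfOf q g N F).z e f ∈ Set.Icc (0 : ℝ) 1 := by
    intro e f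
    simp only [mcfOf]
    split_ifs
    exacts [hsub _, ⟨le_rfl, zero_le_one⟩]
  refine ⟨⟨Finset.sum_nonneg fun m _ => hg m, hg1⟩, fun i _ => hy i, fun e _ f _ => hz e f, ?_, ?_,
    ?_, ?_, ?_, fun τ u _ => rfl, fun f _ => rfl⟩
  · rintro (⟨τ, u⟩ | f) -
    · exact Finset.sum_nonneg fun i _ => mul_nonneg (q.nodeDemand_nonneg i) (hy i u).1
    · exact Finset.sum_nonneg fun e he => mul_nonneg (q.edgeDemand_nonneg e (hF he)) (hz e f).1
  · intro i _
    exact Finset.sum_fiberwise_of_maps_to (fun m _ => m.2.1 i) _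
  · intro i _
    refine Finset.sum_eq_zero fun u hu => Finset.sum_eq_zero fun m hm => ?_
    rw [Finset.mem_compl] at hu
    exact absurd ((Finset.mem_filter.1 hm).2 ▸ m.2.1 i) hu
  · intro e he u
    have heE := hF he
    have h1 : ∀ (p : V × V → Prop) [DecidablePred p],
        ∑ f ∈ S.E with p f, (mcfOf q g N F).z e f =
          ∑ m, g m * ∑ f ∈ S.E with p f, if f ∈ m.1.2 ⟨e, heE⟩ then (1 : ℝ) else 0 := by
      intro p _
      simp only [mcfOf, heE, dif_pos, Finset.sum_filter (s := Finset.univ), Finset.mul_sum]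
      rw [Finset.sum_comm]
      refine Finset.sum_congr rfl fun m _ => Finset.sum_congr rfl fun f _ => ?_
      split_ifs <;> simp
    rw [h1, h1, ← Finset.sum_sub_distrib]
    simp only [mcfOf, Finset.sum_filter (s := Finset.univ)]
    rw [← Finset.sum_sub_distrib]
    refine Finset.sum_congr rfl fun m _ => ?_
    have h2 := m.2.2 ⟨e, heE⟩
    have h3 := h2.1.flow (fun f hf => (q.eloc_spec e heE f (h2.2 hf)).1 : _ ⊆ S.E) u
    rw [← mul_sub, h3, mul_sub]
    split_ifs <;> simp
  · intro e he f hf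
    have heE := hF he
    simp only [mcfOf, heE, dif_pos]
    refine Finset.sum_eq_zero fun m hm => ?_
    exact absurd ((m.2.2 ⟨e, heE⟩).2 (Finset.mem_filter.1 hm).2) (Finset.mem_sdiff.1 hf).2

/-- The solution of the novel LP that is induced by weights `g` on the valid mappings: the copy
`[C, w]` receives the weights of the mappings that place the target of `C` at `w`. -/
def lpOf (q : Request S W) (o : Reorientation q.E) (g : ValidMapping q → ℝ) : LPVars W V T where
  x := ∑ m, g m
  y i u := ∑ m with m.1.1 i = u, g m
  a ρ := ∑ m, g m * alloc m ρ
  forest := mcfOf q g Finset.univ (forestEdges q.E)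
  cyc C w := mcfOf q (fun m => if m.1.1 (target o C) = w then g m else 0) (verts C) C

/-- The edge set of a cactus graph is partitioned into the cycles and the remaining forest. -/
theorem IsCactus.sum_edges {E : Finset (W × W)} (hE : IsCactus E) (φ : W × W → ℝ) :
    ∑ e ∈ E, φ e = ∑ e ∈ forestEdges E, φ e + ∑ C ∈ cycles E, ∑ e ∈ C, φ e := by
  have h1 : ∑ C ∈ cycles E, ∑ e ∈ C, φ e = ∑ e ∈ (cycles E).biUnion id, φ e :=
    (Finset.sum_biUnion fun C hC C' hC' hne => Finset.disjoint_left.2 fun e he he' =>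
      hne (hE.cycles_disjoint hC hC' he he')).symm
  have h2 : (cycles E).biUnion id = E \ forestEdges E := by
    ext e
    simp only [Finset.mem_biUnion, id, forestEdges, Finset.mem_sdiff, Finset.mem_filter]
    constructor
    · rintro ⟨C, hC, he⟩
      exact ⟨subset_of_mem_cycles hC he, fun h => h.2 C hC he⟩
    · rintro ⟨he, h⟩
      by_contra! h'
      exact h ⟨he, h'⟩
  have h3 : forestEdges E ⊆ E := Finset.filter_subset _ _
  rw [h1, h2, add_comm, Finset.sum_sdiff h3]

theorem lpOf_feasible (hE : IsCactus q.E) (o : Reorientation q.E) (hg : ∀ m, 0 ≤ g m)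
    (hg1 : ∑ m, g m ≤ 1) : (lpOf q o g).Feasible q o := by
  have hsplit : ∀ C, ∀ (p : ValidMapping q → Prop) [DecidablePred p],
      ∑ w ∈ q.loc (target o C), ∑ m with p m, (if m.1.1 (target o C) = w then g m else 0) =
        ∑ m with p m, g m := by
    intro C p _
    rw [Finset.sum_comm]
    refine Finset.sum_congr rfl fun m _ => ?_
    rw [Finset.sum_ite_eq, if_pos (m.2.1 _)]
  have hforest := mcfOf_feasible (N := Finset.univ) hg hg1
    (Finset.filter_subset _ _ : forestEdges q.E ⊆ q.E)
  refine ⟨hforest.x_mem, fun i u => hforest.y_mem i (Finset.mem_univ i) u,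
    fun ρ _ => Finset.sum_nonneg fun m _ => mul_nonneg (hg m) (alloc_nonneg m ρ), hforest,
    fun C hC w _ => mcfOf_feasible (fun m => ?_) ?_ (subset_of_mem_cycles hC),
    fun i => (hforest.node i (Finset.mem_univ i)).symm, fun i u _ => rfl,
    fun C _ i _ u _ => (hsplit C _).symm, ?_, fun τ u _ => ?_, fun f _ => ?_⟩
  · split_ifs
    exacts [hg m, le_rfl]
  · refine (Finset.sum_le_sum fun m _ => ?_).trans hg1
    split_ifs
    exacts [le_rfl, hg m]
  · intro C _ w _ u hu
    refine Finset.sum_eq_zero fun m hm => if_neg fun h => ?_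
    have := (Finset.mem_filter.1 hm).2
    exact (Finset.mem_sdiff.1 hu).2 (Finset.mem_singleton.2 (this.symm.trans h))
  · simp only [lpOf, alloc, Finset.mul_sum]
    simp only [← Finset.filter_filter, Finset.sum_filter (s := Finset.univ.filter _)]
    rw [Finset.sum_comm]
    refine Finset.sum_congr rfl fun i _ => ?_
    rw [Finset.sum_filter]
    refine Finset.sum_congr rfl fun m _ => ?_
    split_ifs <;> ring
  · have hz : ∑ m, g m * alloc m (Sum.inr f) =
        ∑ e ∈ q.E, q.edgeDemand e * (mcfOf q g Finset.univ q.E).z e f := by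
      rw [← Finset.sum_coe_sort q.E]
      simp only [mcfOf, Finset.coe_mem, dif_pos, alloc, Finset.mul_sum,
        Finset.sum_filter (s := Finset.univ)]
      rw [Finset.sum_comm]
      refine Finset.sum_congr rfl fun e _ => Finset.sum_congr rfl fun m _ => ?_
      split_ifs <;> ring
    change ∑ m, g m * alloc m (Sum.inr f) = _
    rw [hz, hE.sum_edges]
    refine congrArg₂ (· + ·) rfl (Finset.sum_congr rfl fun C hC => ?_)
    simp only [lpOf, mcfOf, Sum.elim_inr]
    rw [Finset.sum_comm]
    refine Finset.sum_congr rfl fun e he => ?_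
    simp only [subset_of_mem_cycles hC he, dif_pos]
    rw [← Finset.mul_sum, hsplit]

end Compose

section Optimum

variable {V T R : Type*} [Fintype V] [Fintype T] {S : Substrate V T}
  {W : R → Type*} [∀ r, Fintype (W r)] {Q : ∀ r, Request S (W r)}

/-- Convex combinations of valid mappings that respect the capacities yield LP solutions. -/
theorem lpFeasible_lpOf (hc : ∀ r, IsCactus (Q r).E) (o : ∀ r, Reorientation (Q r).E)
    {A : Finset R} {g : ∀ r, ValidMapping (Q r) → ℝ} (hg : ∀ r m, 0 ≤ g r m)
    (hg1 : ∀ r, ∑ m, g r m ≤ 1)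
    (hcap : ∀ ρ ∈ S.resources, ∑ r ∈ A, ∑ m, g r m * alloc m ρ ≤ S.cap ρ) :
    LPFeasible Q o A fun r => lpOf (Q r) (o r) (g r) :=
  ⟨fun r _ => lpOf_feasible (hc r) (o r) (hg r) (hg1 r), hcap⟩

/-- The novel LP has optimal solutions: by the decomposition it suffices to optimize over the
convex combinations of valid mappings, which form a compact set. -/
theorem exists_isLPOptimal (hc : ∀ r, IsCactus (Q r).E) (o : ∀ r, Reorientation (Q r).E)
    (A : Finset R) (b : R → ℝ) : ∃ v, IsLPOptimal Q o A b v := by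
  set K : Set (∀ r, ValidMapping (Q r) → ℝ) :=
    {g | (∀ r m, 0 ≤ g r m) ∧ (∀ r, ∑ m, g r m ≤ 1) ∧
      ∀ ρ ∈ S.resources, ∑ r ∈ A, ∑ m, g r m * alloc m ρ ≤ S.cap ρ} with hK
  have hclosed : IsClosed K := by
    simp only [hK, Set.ofPred_and, Set.ofPred_forall]
    refine .inter ?_ (.inter ?_ ?_)
    · exact isClosed_iInter fun r => isClosed_iInter fun m =>
        isClosed_le continuous_const (by fun_prop)
    · exact isClosed_iInter fun r => isClosed_le (by fun_prop) continuous_const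
    · exact isClosed_iInter fun ρ => isClosed_iInter fun _ =>
        isClosed_le (by fun_prop) continuous_const
  have hcompact : IsCompact K := by
    refine (isCompact_univ_pi fun r => isCompact_univ_pi fun (m : ValidMapping (Q r)) =>
      isCompact_Icc (a := (0 : ℝ)) (b := 1)).of_isClosed_subset hclosed ?_
    intro g hg
    refine Set.mem_univ_pi.2 fun r => Set.mem_univ_pi.2 fun m => ⟨hg.1 r m, ?_⟩
    exact (Finset.single_le_sum (fun m _ => hg.1 r m) (Finset.mem_univ m)).trans (hg.2.1 r)
  have hne : K.Nonempty :=
    ⟨fun _ _ => 0, fun _ _ => le_rfl, fun r => by simp, fun ρ hρ => by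
      simpa using (cap_pos hρ).le⟩
  obtain ⟨g, hg, hmax⟩ := hcompact.exists_isMaxOn hne
    (f := fun g : ∀ r, ValidMapping (Q r) → ℝ => ∑ r ∈ A, b r * ∑ m, g r m)
    (Continuous.continuousOn (by fun_prop))
  refine ⟨_, lpFeasible_lpOf hc o hg.1 hg.2.1 hg.2.2, fun v hv => ?_⟩
  have hD : ∀ r, ∃ D : ConvexComb (Q r), r ∈ A → IsDecomposition (v r) D := by
    intro r
    by_cases hr : r ∈ A
    · obtain ⟨D, hD⟩ := (hv.1 r hr).exists_isDecomposition (hc r)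
      exact ⟨D, fun _ => hD⟩
    · exact ⟨⟨fun _ => 0, by simp⟩, fun h => absurd h hr⟩
  choose D hD using hD
  have hDK : (fun r m => ((D r).weight m : ℝ)) ∈ K := by
    refine ⟨fun r m => NNReal.coe_nonneg _, fun r => ?_, fun ρ hρ => ?_⟩
    · beta_reduce
      exact_mod_cast (D r).sum_le_one
    · exact (Finset.sum_le_sum fun r hr => (hD r hr).2 ρ hρ).trans (hv.2 ρ hρ)
  refine le_of_eq_of_le (Finset.sum_congr rfl fun r hr => ?_) (hmax hDK)
  rw [(hD r hr).1]

end Optimum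

/-! ### Tail bounds for independent choices -/

section Tail

open MeasureTheory ProbabilityTheory in
/-- Hoeffding's lemma on a finite probability space. -/
theorem sum_mul_exp_le {α : Type*} [Fintype α] (p : PMF α) {X : α → ℝ} {M : ℝ}
    (hX : ∀ a, X a ∈ Set.Icc 0 M) (t : ℝ) :
    ∑ a, (p a).toReal * Real.exp (t * X a) ≤
      Real.exp (t * ∑ a, (p a).toReal * X a + M ^ 2 * t ^ 2 / 8) := by
  let _ : MeasurableSpace α := ⊤
  have h := (hasSubgaussianMGF_of_mem_Icc (μ := p.toMeasure) (X := X) (a := 0) (b := M)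
    (Measurable.of_discrete.aemeasurable) (Filter.Eventually.of_forall hX)).mgf_le t
  rw [mgf, PMF.integral_eq_sum, PMF.integral_eq_sum] at h
  simp only [smul_eq_mul] at h
  set m := ∑ a, (p a).toReal * X a
  have h1 : ∑ a, (p a).toReal * Real.exp (t * X a) =
      Real.exp (t * m) * ∑ a, (p a).toReal * Real.exp (t * (X a - m)) := by
    rw [Finset.mul_sum]
    refine Finset.sum_congr rfl fun a _ => ?_
    rw [mul_left_comm, ← Real.exp_add]
    ring_nf
  rw [h1, Real.exp_add]
  refine mul_le_mul_of_nonneg_left (h.trans_eq ?_) (Real.exp_pos _).le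
  congr 1
  simp only [sub_zero, NNReal.coe_pow, NNReal.coe_div, coe_nnnorm, Real.norm_eq_abs,
    NNReal.coe_ofNat]
  rw [div_pow, sq_abs]
  ring

theorem sum_toReal {α : Type*} [Fintype α] (p : PMF α) : ∑ a, (p a).toReal = 1 := by
  rw [← ENNReal.toReal_sum fun a _ => p.apply_ne_top a, ← tsum_fintype (L := .unconditional _),
    p.tsum_coe, ENNReal.toReal_one]

variable {ι : Type*} [Fintype ι] {α : ι → Type*} [∀ i, Fintype (α i)]

theorem productPMF_toReal (p : ∀ i, PMF (α i)) (s : ∀ i, α i) :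
    (productPMF p s).toReal = ∏ i, (p i (s i)).toReal := by
  rw [productPMF, PMF.ofFintype_apply, ENNReal.toReal_prod]

/-- The exponential Markov inequality for a sum of independent random variables. -/
theorem productPMF_exp_markov (p : ∀ i, PMF (α i)) (Y : ∀ i, α i → ℝ) (c : ℝ)
    {B : (∀ i, α i) → Prop} (hB : ∀ s, B s → c ≤ ∑ i, Y i (s i)) :
    ∑ s with B s, (productPMF p s).toReal ≤
      Real.exp (-c) * ∏ i, ∑ a, (p i a).toReal * Real.exp (Y i a) := by
  rw [Fintype.prod_sum, Finset.mul_sum, Finset.sum_filter]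
  refine Finset.sum_le_sum fun s _ => ?_
  rw [Finset.prod_mul_distrib, ← productPMF_toReal, ← Real.exp_sum, mul_left_comm,
    ← Real.exp_add]
  split_ifs with h
  · refine le_mul_of_one_le_right ENNReal.toReal_nonneg (Real.one_le_exp ?_)
    linarith [hB s h]
  · exact mul_nonneg ENNReal.toReal_nonneg (Real.exp_pos _).le

/-- Hoeffding's inequality, in a form that includes the case that all variables vanish. -/
theorem productPMF_hoeffding (p : ∀ i, PMF (α i)) {X : ∀ i, α i → ℝ} {M : ι → ℝ} {c t L : ℝ}
    (hX : ∀ i a, X i a ∈ Set.Icc 0 (M i)) (hc : 0 ≤ c) (ht : 0 ≤ t)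
    (hmean : ∑ i, ∑ a, (p i a).toReal * X i a ≤ c) (hL : L * ∑ i, M i ^ 2 ≤ 2 * t ^ 2) :
    ∑ s with c + t < ∑ i, X i (s i), (productPMF p s).toReal ≤ Real.exp (-L) := by
  have hS : 0 ≤ ∑ i, M i ^ 2 := Finset.sum_nonneg fun i _ => sq_nonneg _
  rcases hS.eq_or_lt with hS | hS
  · have hM : ∀ i, M i = 0 := fun i => pow_eq_zero_iff two_ne_zero |>.1
      ((Finset.sum_eq_zero_iff_of_nonneg fun i _ => sq_nonneg _).1 hS.symm i (Finset.mem_univ i))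
    have hX0 : ∀ i a, X i a = 0 := fun i a => le_antisymm (hM i ▸ (hX i a).2) (hX i a).1
    rw [Finset.sum_eq_zero fun s hs => ?_]
    · exact (Real.exp_pos _).le
    · have := (Finset.mem_filter.1 hs).2
      simp only [hX0, Finset.sum_const_zero] at this
      linarith
  -- the optimal parameter of the exponential moment
  set S := ∑ i, M i ^ 2 with hSdef
  set l := 4 * t / S with hl
  have hl0 : 0 ≤ l := by positivity
  refine (productPMF_exp_markov p (fun i a => l * X i a) (l * (c + t)) fun s hs => ?_).trans ?_
  · rw [← Finset.mul_sum]
    exact mul_le_mul_of_nonneg_left hs.le hl0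
  have h1 : ∏ i, ∑ a, (p i a).toReal * Real.exp (l * X i a) ≤
      Real.exp (∑ i, (l * ∑ a, (p i a).toReal * X i a + M i ^ 2 * l ^ 2 / 8)) := by
    rw [Real.exp_sum]
    exact Finset.prod_le_prod (fun i _ => Finset.sum_nonneg fun a _ =>
      mul_nonneg ENNReal.toReal_nonneg (Real.exp_pos _).le) fun i _ => sum_mul_exp_le (p i) (hX i) l
  refine (mul_le_mul_of_nonneg_left h1 (Real.exp_pos _).le).trans ?_
  rw [← Real.exp_add, Real.exp_le_exp, Finset.sum_add_distrib, ← Finset.mul_sum,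
    ← Finset.sum_div, ← Finset.sum_mul]
  have h2 := mul_le_mul_of_nonneg_left hmean hl0
  have h3 : S * l ^ 2 / 8 - l * t = -(2 * t ^ 2 / S) := by
    rw [hl]
    field_simp
    ring
  have h4 : L ≤ 2 * t ^ 2 / S := (le_div_iff₀ hS).2 hL
  rw [← hSdef]
  linarith

/-- A lower tail bound for a sum of variables in `[0, 1]` with mean one: the exponential moment
of parameter `-1` suffices. -/
theorem productPMF_lower_tail (p : ∀ i, PMF (α i)) {X : ∀ i, α i → ℝ}
    (hX : ∀ i a, X i a ∈ Set.Icc (0 : ℝ) 1)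
    (hmean : ∑ i, ∑ a, (p i a).toReal * X i a = 1) :
    ∑ s with ∑ i, X i (s i) < 1 / 3, (productPMF p s).toReal ≤
      Real.exp (Real.exp (-1) - 2 / 3) := by
  refine (productPMF_exp_markov p (fun i a => -X i a) (-(1 / 3)) fun s hs => ?_).trans ?_
  · rw [Finset.sum_neg_distrib]
    linarith
  have h0 : ∀ i a, Real.exp (-X i a) ≤ 1 + (Real.exp (-1) - 1) * X i a := by
    intro i a
    have := convexOn_exp.2 (Set.mem_univ (-1)) (Set.mem_univ 0) (hX i a).1
      (sub_nonneg.2 (hX i a).2) (by ring)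
    simp only [smul_eq_mul, mul_neg, mul_one, mul_zero, add_zero, Real.exp_zero] at this
    linarith
  have h1 : ∏ i, ∑ a, (p i a).toReal * Real.exp (-X i a) ≤
      Real.exp (∑ i, (Real.exp (-1) - 1) * ∑ a, (p i a).toReal * X i a) := by
    rw [Real.exp_sum]
    refine Finset.prod_le_prod (fun i _ => Finset.sum_nonneg fun a _ =>
      mul_nonneg ENNReal.toReal_nonneg (Real.exp_pos _).le) fun i _ => ?_
    refine (Finset.sum_le_sum fun a _ => mul_le_mul_of_nonneg_left (h0 i a)
      ENNReal.toReal_nonneg).trans ?_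
    refine le_trans (le_of_eq ?_) (Real.add_one_le_exp _)
    simp only [mul_add, mul_one, Finset.sum_add_distrib, sum_toReal, Finset.mul_sum]
    rw [add_comm]
    congr 1
    exact Finset.sum_congr rfl fun a _ => by ring
  refine (mul_le_mul_of_nonneg_left h1 (Real.exp_pos _).le).trans ?_
  rw [← Real.exp_add, ← Finset.mul_sum, hmean, Real.exp_le_exp]
  linarith

end Tail

/-! ### Loads and profit of a rounding try -/

section Rounding

theorem bddAbove_of_exists_mem {ι : Type*} [Finite ι] (p : ι → Prop) (f : ι → ℝ) :
    BddAbove (insert 0 {t | ∃ i, p i ∧ t = f i}) := by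
  refine Set.Finite.bddAbove (Set.Finite.insert _ ((Set.finite_range f).subset ?_))
  rintro _ ⟨i, -, rfl⟩
  exact ⟨i, rfl⟩

theorem le_sSup_insert {ι : Type*} [Finite ι] {p : ι → Prop} {f : ι → ℝ} {i : ι} (hi : p i) :
    f i ≤ sSup (insert 0 {t | ∃ i, p i ∧ t = f i}) :=
  le_csSup (bddAbove_of_exists_mem p f) (Set.mem_insert_of_mem _ ⟨i, hi, rfl⟩)

theorem sSup_insert_nonneg {ι : Type*} [Finite ι] (p : ι → Prop) (f : ι → ℝ) :
    0 ≤ sSup (insert 0 {t | ∃ i, p i ∧ t = f i}) :=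
  le_csSup (bddAbove_of_exists_mem p f) (Set.mem_insert _ _)

variable {V T W : Type*} [Fintype W] {S : Substrate V T} {q : Request S W}

theorem nodeDemand_le_maxDemand {i : W} {u : V} (hu : u ∈ q.loc i) :
    q.nodeDemand i ≤ maxDemand q (Sum.inl (q.type i, u)) := by
  have := le_sSup_insert (p := fun j => q.type j = q.type i ∧ u ∈ q.loc j) (f := q.nodeDemand)
    ⟨rfl, hu⟩
  simpa only [maxDemand, and_assoc] using this

theorem edgeDemand_le_maxDemand {e : W × W} (he : e ∈ q.E) {f : V × V} (hf : f ∈ q.eloc e) :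
    q.edgeDemand e ≤ maxDemand q (Sum.inr f) := by
  have := le_sSup_insert (p := fun e => e ∈ q.E ∧ f ∈ q.eloc e) (f := q.edgeDemand) ⟨he, hf⟩
  simpa only [maxDemand, and_assoc] using this

/-- A request without demand for a resource does not use it. -/
theorem alloc_eq_zero {ρ : Res V T} (h : ¬ 0 < maxDemand q ρ) (m : ValidMapping q) :
    alloc m ρ = 0 := by
  rcases ρ with ⟨τ, u⟩ | f
  · refine Finset.sum_eq_zero fun i hi => le_antisymm ?_ (q.nodeDemand_nonneg i)
    obtain ⟨-, rfl, rfl⟩ := Finset.mem_filter.1 hi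
    exact (nodeDemand_le_maxDemand (m.2.1 i)).trans (not_lt.1 h)
  · refine Finset.sum_eq_zero fun e he => le_antisymm ?_ (q.edgeDemand_nonneg e e.2)
    exact (edgeDemand_le_maxDemand e.2 ((m.2.2 e).2 (Finset.mem_filter.1 he).2)).trans
      (not_lt.1 h)

theorem alloc_le_maxAlloc [Fintype V] (m : ValidMapping q) (ρ : Res V T) :
    alloc m ρ ≤ maxAlloc q ρ :=
  le_ciSup (f := fun m : ValidMapping q => alloc m ρ) (Set.finite_range _).bddAbove m

theorem maxAlloc_nonneg (ρ : Res V T) : 0 ≤ maxAlloc q ρ :=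
  Real.iSup_nonneg fun m => alloc_nonneg m ρ

theorem maxAlloc_eq_zero {ρ : Res V T} (h : ¬ 0 < maxDemand q ρ) : maxAlloc q ρ = 0 := by
  simp only [maxAlloc, alloc_eq_zero h, Real.iSup_const_zero]

theorem select_some [Fintype V] (D : ConvexComb q) (m : ValidMapping q) :
    (D.select (some m)).toReal = D.weight m := by
  rw [ConvexComb.select, PMF.ofFintype_apply]
  rfl

end Rounding

section Load

variable {V T R : Type*} [Fintype V] [Fintype T] {S : Substrate V T} {W : R → Type*}
  {Q : ∀ r, Request S (W r)}

theorem maxDemand_le_eps [Finite R] {A : Finset R} {r : R} (hr : r ∈ A) {ρ : Res V T}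
    (hρ : ρ ∈ S.resources) : maxDemand (Q r) ρ ≤ eps Q A * S.cap ρ := by
  rw [← div_le_iff₀ (cap_pos hρ)]
  have := le_sSup_insert (p := fun x : R × Res V T => x.1 ∈ A ∧ x.2 ∈ S.resources)
    (f := fun x => maxDemand (Q x.1) x.2 / S.cap x.2) (i := (r, ρ)) ⟨hr, hρ⟩
  simpa only [eps, Prod.exists, and_assoc, exists_and_left] using this

theorem eps_nonneg [Finite R] (A : Finset R) : 0 ≤ eps Q A := by
  have := sSup_insert_nonneg (fun x : R × Res V T => x.1 ∈ A ∧ x.2 ∈ S.resources)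
    (fun x => maxDemand (Q x.1) x.2 / S.cap x.2)
  simpa only [eps, Prod.exists, and_assoc, exists_and_left] using this

variable [∀ r, Fintype (W r)]

theorem Delta_le_DeltaMax (A : Finset R) {X : Finset (Res V T)} {ρ : Res V T} (hρ : ρ ∈ X) :
    Delta Q A ρ ≤ DeltaMax Q A X :=
  le_sSup_insert (p := fun ρ => ρ ∈ X) (f := Delta Q A) hρ

/-- The sum of squares in Hoeffding's inequality, in terms of the factors of the theorem. -/
theorem sum_sq_maxAlloc_le [Finite R] (A : Finset R) {X : Finset (Res V T)} {ρ : Res V T}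
    (hρX : ρ ∈ X) (hρ : ρ ∈ S.resources) :
    ∑ r ∈ A, maxAlloc (Q r) ρ ^ 2 ≤ (eps Q A * S.cap ρ) ^ 2 * DeltaMax Q A X := by
  refine le_trans ?_ (mul_le_mul_of_nonneg_left (Delta_le_DeltaMax A hρX) (sq_nonneg _))
  rw [Delta, Finset.mul_sum, Finset.sum_filter]
  refine Finset.sum_le_sum fun r hr => ?_
  split_ifs with h
  · rw [div_pow, mul_div_assoc', le_div_iff₀ (by positivity), mul_comm]
    exact mul_le_mul_of_nonneg_right (pow_le_pow_left₀ h.le (maxDemand_le_eps hr hρ) 2)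
      (sq_nonneg _)
  · rw [maxAlloc_eq_zero h]
    simp

end Load

section Choice

variable {V T R : Type*} [Fintype V] [Fintype R] {S : Substrate V T} {W : R → Type*}
  [∀ r, Fintype (W r)] {Q : ∀ r, Request S (W r)}

/-- The distribution of the choice for a single request. -/
def choicePMF (A : Finset R) (D : ∀ r, ConvexComb (Q r)) (r : R) :
    PMF (Option (ValidMapping (Q r))) := if r ∈ A then (D r).select else PMF.pure none

theorem roundOnce_eq (A : Finset R) (D : ∀ r, ConvexComb (Q r)) :
    roundOnce A D = productPMF (choicePMF A D) := rfl

/-- Quantities that vanish on rejected requests only depend on the requests in `A`, almost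
surely. -/
theorem sum_eq_of_roundOnce_ne_zero {A : Finset R} {D : ∀ r, ConvexComb (Q r)} {s : Solution Q}
    (hs : (roundOnce A D s).toReal ≠ 0) {G : ∀ r, Option (ValidMapping (Q r)) → ℝ}
    (hG : ∀ r, G r none = 0) : ∑ r, G r (s r) = ∑ r, if r ∈ A then G r (s r) else 0 := by
  refine Finset.sum_congr rfl fun r _ => ?_
  split_ifs with hr
  · rfl
  have h : s r = none := by
    by_contra h
    refine hs ?_
    rw [roundOnce_eq, productPMF_toReal]
    refine Finset.prod_eq_zero (Finset.mem_univ r) ?_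
    rw [choicePMF, if_neg hr, PMF.pure_apply, if_neg h, ENNReal.toReal_zero]
  rw [h, hG]

/-- The expectation of a sum over the requests that vanishes on rejected requests. -/
theorem sum_choicePMF {A : Finset R} (D : ∀ r, ConvexComb (Q r))
    {G : ∀ r, Option (ValidMapping (Q r)) → ℝ} (hG : ∀ r, G r none = 0) :
    ∑ r, ∑ c, (choicePMF A D r c).toReal * (if r ∈ A then G r c else 0) =
      ∑ r ∈ A, ∑ m, ((D r).weight m : ℝ) * G r (some m) := by
  rw [← Finset.sum_filter_add_sum_filter_not Finset.univ (· ∈ A),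
    Finset.sum_eq_zero (s := Finset.univ.filter (· ∉ A)) fun r hr => ?_, add_zero,
    Finset.filter_mem_eq_inter, Finset.univ_inter]
  · refine Finset.sum_congr rfl fun r hr => ?_
    rw [Fintype.sum_option]
    simp only [hr, if_true, hG, mul_zero, zero_add, choicePMF, select_some]
  · simp [(Finset.mem_filter.1 hr).2]

variable [Fintype T] {o : ∀ r, Reorientation (Q r).E} {A : Finset R} {v : ∀ r, LPVars (W r) V T}
  {D : ∀ r, ConvexComb (Q r)}

/-- Some resource in `X` is overloaded with probability at most `n⁻⁴` times the size of `X`: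
Hoeffding's inequality bounds the probability of each single overload by `n⁻⁴`, since the squared
excess load is at least `2 * log n` times the sum of the squared maximal allocations. -/
theorem roundOnce_overload (hv : LPFeasible Q o A v) (hD : ∀ r ∈ A, IsDecomposition (v r) (D r))
    {X : Finset (Res V T)} (hX : X ⊆ S.resources) {n : ℝ} (hn : X.Nonempty → 1 ≤ n) :
    ∑ s with ∃ ρ ∈ X, (1 + eps Q A * Real.sqrt (2 * DeltaMax Q A X * Real.log n)) * S.cap ρ <
      load s ρ, (roundOnce A D s).toReal ≤ X.card * Real.exp (-(4 * Real.log n)) := by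
  set β := eps Q A * Real.sqrt (2 * DeltaMax Q A X * Real.log n) with hβ
  have hβ0 : 0 ≤ β := mul_nonneg (eps_nonneg A) (Real.sqrt_nonneg _)
  have h1 : ∑ s with ∃ ρ ∈ X, (1 + β) * S.cap ρ < load s ρ, (roundOnce A D s).toReal ≤
      ∑ ρ ∈ X, ∑ s with (1 + β) * S.cap ρ < load s ρ, (roundOnce A D s).toReal := by
    simp only [Finset.sum_filter]
    rw [Finset.sum_comm]
    refine Finset.sum_le_sum fun s _ => ?_
    split_ifs with h
    · obtain ⟨ρ, hρ, h⟩ := h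
      refine le_trans (by rw [if_pos h]) (Finset.single_le_sum (f := fun ρ =>
        if (1 + β) * S.cap ρ < load s ρ then (roundOnce A D s).toReal else 0) (fun ρ _ => ?_) hρ)
      split_ifs
      exacts [ENNReal.toReal_nonneg, le_rfl]
    · refine Finset.sum_nonneg fun ρ _ => ?_
      split_ifs
      exacts [ENNReal.toReal_nonneg, le_rfl]
  refine h1.trans ?_
  rw [← nsmul_eq_mul]
  refine Finset.sum_le_card_nsmul _ _ _ fun ρ hρ => ?_
  have hρS := hX hρ
  have hcap := cap_pos hρS
  set G : ∀ r, Option (ValidMapping (Q r)) → ℝ := fun r c => c.elim 0 fun m => alloc m ρ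
  have hG : ∀ r, G r none = 0 := fun r => rfl
  have h2 := productPMF_hoeffding (choicePMF A D) (X := fun r c => if r ∈ A then G r c else 0)
    (M := fun r => if r ∈ A then maxAlloc (Q r) ρ else 0) (c := S.cap ρ) (t := β * S.cap ρ)
    (L := 4 * Real.log n) (fun r c => ?_) hcap.le (mul_nonneg hβ0 hcap.le) ?_ ?_
  · refine le_trans (le_of_eq ?_) h2
    rw [Finset.sum_filter, Finset.sum_filter]
    refine Finset.sum_congr rfl fun s _ => ?_
    by_cases hs : (roundOnce A D s).toReal = 0
    · rw [← roundOnce_eq, hs, ite_self, ite_self]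
    · rw [← sum_eq_of_roundOnce_ne_zero hs hG, roundOnce_eq]
      refine if_congr ?_ rfl rfl
      rw [add_mul, one_mul]
      rfl
  · split_ifs
    · cases c with
      | none => exact ⟨le_rfl, maxAlloc_nonneg ρ⟩
      | some m => exact ⟨alloc_nonneg m ρ, alloc_le_maxAlloc m ρ⟩
    · exact ⟨le_rfl, le_rfl⟩
  · rw [sum_choicePMF D hG]
    exact (Finset.sum_le_sum fun r hr => (hD r hr).2 ρ hρS).trans (hv.2 ρ hρS)
  · have hn1 : 0 ≤ Real.log n := Real.log_nonneg (hn ⟨ρ, hρ⟩)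
    have hΔ : 0 ≤ DeltaMax Q A X := sSup_insert_nonneg (fun ρ => ρ ∈ X) (Delta Q A)
    have h3 : ∑ r, (if r ∈ A then maxAlloc (Q r) ρ else 0) ^ 2 =
        ∑ r ∈ A, maxAlloc (Q r) ρ ^ 2 := by
      rw [← Finset.sum_filter_add_sum_filter_not Finset.univ (· ∈ A),
        Finset.sum_eq_zero (s := Finset.univ.filter (· ∉ A)) fun r hr => by
          simp [(Finset.mem_filter.1 hr).2], add_zero, Finset.filter_mem_eq_inter,
        Finset.univ_inter]
      exact Finset.sum_congr rfl fun r hr => by simp [hr]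
    have h4 : (β * S.cap ρ) ^ 2 =
        (eps Q A * S.cap ρ) ^ 2 * DeltaMax Q A X * (2 * Real.log n) := by
      rw [hβ, mul_pow, mul_pow, Real.sq_sqrt (by positivity)]
      ring
    rw [h3, h4]
    have := mul_le_mul_of_nonneg_right (sum_sq_maxAlloc_le (Q := Q) A hρ hρS)
      (show 0 ≤ 4 * Real.log n by positivity)
    linarith

/-- The profit of a rounding try is less than a third of its expectation with probability at most
`exp (e⁻¹ - 2 / 3)`, provided that no single profit exceeds the expectation. -/
theorem roundOnce_profit (hD : ∀ r ∈ A, IsDecomposition (v r) (D r)) {B : ℝ}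
    (hB : ∑ r ∈ A, (Q r).profit * (v r).x = B) (hmax : ∀ r ∈ A, (Q r).profit ≤ B) :
    ∑ s with profit s < 1 / 3 * B, (roundOnce A D s).toReal ≤
      Real.exp (Real.exp (-1) - 2 / 3) := by
  have hB0 : A.Nonempty → 0 < B := fun ⟨r, hr⟩ => (Q r).profit_pos.trans_le (hmax r hr)
  by_cases hA : A.Nonempty
  swap
  · rw [Finset.not_nonempty_iff_eq_empty.1 hA, Finset.sum_empty] at hB
    rw [Finset.sum_eq_zero fun s hs => ?_]
    · exact (Real.exp_pos _).le
    · have h1 := (Finset.mem_filter.1 hs).2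
      have h2 : 0 ≤ profit s := Finset.sum_nonneg fun r _ => by
        split_ifs
        exacts [(Q r).profit_pos.le, le_rfl]
      rw [← hB, mul_zero] at h1
      exact absurd h1 (not_lt.2 h2)
  have hBpos := hB0 hA
  set G : ∀ r, Option (ValidMapping (Q r)) → ℝ :=
    fun r c => (if c.isSome then (Q r).profit else 0) / B with hGdef
  have hG : ∀ r, G r none = 0 := fun r => by simp [hGdef]
  have h := productPMF_lower_tail (choicePMF A D) (X := fun r c => if r ∈ A then G r c else 0)
    (fun r c => ?_) ?_
  · refine le_trans (le_of_eq ?_) h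
    rw [Finset.sum_filter, Finset.sum_filter]
    refine Finset.sum_congr rfl fun s _ => ?_
    by_cases hs : (roundOnce A D s).toReal = 0
    · rw [← roundOnce_eq, hs, ite_self, ite_self]
    · rw [← sum_eq_of_roundOnce_ne_zero hs hG, roundOnce_eq]
      refine if_congr ?_ rfl rfl
      simp only [hGdef]
      rw [← Finset.sum_div, div_lt_iff₀ hBpos]
      rfl
  · split_ifs with hr
    · simp only [hGdef]
      split_ifs
      · exact ⟨div_nonneg (Q r).profit_pos.le hBpos.le, (div_le_one hBpos).2 (hmax r hr)⟩
      · simp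
    · simp
  · rw [sum_choicePMF D hG]
    simp only [hGdef, Option.isSome_some, if_true, ← Finset.sum_mul]
    rw [← div_self hBpos.ne']
    conv_rhs => rw [← hB]
    rw [Finset.sum_div]
    refine Finset.sum_congr rfl fun r hr => ?_
    rw [(hD r hr).1, ← hB]
    ring

end Choice

/-! ### Comparison of the LP profit with feasible embeddings -/

section Profit

variable {V T R : Type*} [Fintype V] {S : Substrate V T} {W : R → Type*}
  [∀ r, Fintype (W r)] {Q : ∀ r, Request S (W r)}

/-- The weights of a solution that is regarded as a convex combination. -/
def solWeight (s : Solution Q) (r : R) (m : ValidMapping (Q r)) : ℝ :=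
  if s r = some m then 1 else 0

theorem sum_solWeight_mul (s : Solution Q) (r : R) (G : ValidMapping (Q r) → ℝ) :
    ∑ m, solWeight s r m * G m = (s r).elim 0 G := by
  simp only [solWeight, ite_mul, one_mul, zero_mul]
  cases s r <;> simp

theorem sum_solWeight (s : Solution Q) (r : R) :
    ∑ m, solWeight s r m = if (s r).isSome then 1 else 0 := by
  have := sum_solWeight_mul s r fun _ => 1
  simp only [mul_one] at this
  rw [this]
  cases s r <;> simp

variable [Fintype T] [Fintype R]

theorem IsFeasible.lpFeasible (hc : ∀ r, IsCactus (Q r).E) (o : ∀ r, Reorientation (Q r).E)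
    {s : Solution Q} (hs : IsFeasible s) (A : Finset R) :
    LPFeasible Q o A fun r => lpOf (Q r) (o r) (solWeight s r) := by
  refine lpFeasible_lpOf hc o (fun r m => ?_) (fun r => ?_) fun ρ hρ => ?_
  · unfold solWeight
    split_ifs
    exacts [zero_le_one, le_rfl]
  · rw [sum_solWeight]
    split_ifs
    exacts [le_rfl, zero_le_one]
  · simp only [sum_solWeight_mul]
    refine le_trans (Finset.sum_le_sum_of_subset_of_nonneg (Finset.subset_univ A) fun r _ _ => ?_)
      (hs ρ hρ)
    cases s r with
    | none => exact le_rfl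
    | some m => exact alloc_nonneg m ρ

/-- The preprocessing only removes requests that no feasible solution embeds. -/
theorem IsFeasible.mem_kept (hc : ∀ r, IsCactus (Q r).E) (o : ∀ r, Reorientation (Q r).E)
    {s : Solution Q} (hs : IsFeasible s) {r : R} (hr : (s r).isSome) : r ∈ kept Q o := by
  obtain ⟨v, hv⟩ := exists_isLPOptimal hc o {r} fun _ => 1
  refine Finset.mem_filter.2 ⟨Finset.mem_univ r, v, hv, not_lt.2 ?_⟩
  have := hv.2 _ (hs.lpFeasible hc o {r})
  simpa only [lpOf, sum_solWeight, Finset.sum_singleton, hr, if_true, one_mul] using this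

theorem IsFeasible.profit_le (hc : ∀ r, IsCactus (Q r).E) {o : ∀ r, Reorientation (Q r).E}
    {v : ∀ r, LPVars (W r) V T} (hv : IsLPOptimal Q o (kept Q o) (fun r => (Q r).profit) v)
    {s : Solution Q} (hs : IsFeasible s) :
    profit s ≤ ∑ r ∈ kept Q o, (Q r).profit * (v r).x := by
  refine le_of_eq_of_le ?_ (hv.2 _ (hs.lpFeasible hc o _))
  simp only [lpOf, sum_solWeight]
  rw [profit, ← Finset.sum_subset (Finset.subset_univ (kept Q o))]
  · exact Finset.sum_congr rfl fun r _ => by split_ifs <;> simp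
  · intro r _ hr
    exact if_neg fun h => hr (hs.mem_kept hc o h)

theorem optProfit_le (hc : ∀ r, IsCactus (Q r).E) {o : ∀ r, Reorientation (Q r).E}
    {v : ∀ r, LPVars (W r) V T} (hv : IsLPOptimal Q o (kept Q o) (fun r => (Q r).profit) v) :
    optProfit Q ≤ ∑ r ∈ kept Q o, (Q r).profit * (v r).x := by
  refine csSup_le ⟨_, fun _ => none, fun ρ hρ => ?_, rfl⟩ ?_
  · simpa [load] using (cap_pos hρ).le
  · rintro _ ⟨s, hs, rfl⟩
    exact IsFeasible.profit_le hc hv hs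

/-- A kept request can be embedded completely on its own, so that its profit is a lower bound for
the LP profit. -/
theorem profit_le_of_mem_kept (hc : ∀ r, IsCactus (Q r).E) {o : ∀ r, Reorientation (Q r).E}
    {v : ∀ r, LPVars (W r) V T} (hv : IsLPOptimal Q o (kept Q o) (fun r => (Q r).profit) v)
    {r : R} (hr : r ∈ kept Q o) :
    (Q r).profit ≤ ∑ r ∈ kept Q o, (Q r).profit * (v r).x := by
  obtain ⟨-, v', hv', hx⟩ := Finset.mem_filter.1 hr
  have hfeas : LPFeasible Q o (kept Q o)
      fun r' => if r' = r then v' r' else lpOf (Q r') (o r') fun _ => 0 := by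
    refine ⟨fun r' _ => ?_, fun ρ hρ => ?_⟩
    · beta_reduce
      split_ifs with h
      · exact hv'.1.1 r' (Finset.mem_singleton.2 h)
      · exact lpOf_feasible (hc r') (o r') (fun _ => le_rfl) (by simp)
    · rw [Finset.sum_eq_single r (fun r' _ h => by simp [h, lpOf]) fun h => absurd hr h]
      simpa using hv'.1.2 ρ hρ
  refine le_trans ?_ (hv.2 _ hfeas)
  rw [Finset.sum_eq_single r (fun r' _ h => by simp [h, lpOf]) fun h => absurd hr h]
  simp only [if_true]
  exact le_mul_of_one_le_right (Q r).profit_pos.le (not_lt.1 hx)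

end Profit

/-! ### Success probabilities -/

section Success

theorem ofReal_le_toOuterMeasure {α : Type*} [Fintype α] (p : PMF α) {E : Set α} {δ : ℝ}
    (h : ∑ s with s ∉ E, (p s).toReal ≤ 1 - δ) : ENNReal.ofReal δ ≤ p.toOuterMeasure E := by
  have h1 : p.toOuterMeasure E = ENNReal.ofReal (∑ s with s ∈ E, (p s).toReal) := by
    rw [PMF.toOuterMeasure_apply_fintype, ENNReal.ofReal_sum_of_nonneg fun s _ =>
      ENNReal.toReal_nonneg, Finset.sum_filter]
    refine Finset.sum_congr rfl fun s _ => ?_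
    rw [Set.indicator_apply]
    split_ifs
    exacts [(ENNReal.ofReal_toReal (p.apply_ne_top s)).symm, rfl]
  rw [h1]
  refine ENNReal.ofReal_le_ofReal ?_
  have h2 := Finset.sum_filter_add_sum_filter_not Finset.univ (· ∈ E) fun s => (p s).toReal
  rw [sum_toReal] at h2
  linarith

variable {V T R : Type*} [Fintype V] [Fintype R] {S : Substrate V T} {W : R → Type*}
  [∀ r, Fintype (W r)] {Q : ∀ r, Request S (W r)}

/-- The loop fails only if each of its independent tries fails. -/
theorem roundLoop_fail (p : PMF (Solution Q)) (good : Solution Q → Prop) (n : ℕ) :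
    ∑ s with ¬ good s, (roundLoop p good n s).toReal =
      (∑ s with ¬ good s, (p s).toReal) ^ (n + 1) := by
  induction n with
  | zero => simp [roundLoop]
  | succ n ih =>
    rw [pow_succ', ← ih, Finset.mul_sum]
    refine Finset.sum_congr rfl fun s hs => ?_
    have hs' := (Finset.mem_filter.1 hs).2
    rw [roundLoop, PMF.bind_apply, tsum_fintype, ENNReal.toReal_sum fun t _ =>
      ENNReal.mul_ne_top (p.apply_ne_top t) (PMF.apply_ne_top _ s), Finset.sum_mul,
      Finset.sum_filter]
    refine Finset.sum_congr rfl fun t _ => ?_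
    rw [ENNReal.toReal_mul]
    by_cases ht : good t
    · have hst : s ≠ t := fun h => hs' (h ▸ ht)
      simp [ht, PMF.pure_apply, hst]
    · simp [ht]

variable [Fintype T]

theorem card_mul_exp_le {k : ℕ} {n c : ℝ} (hk : (k : ℝ) ≤ n) (hc : 0 < c) (hcn : c ≤ n) :
    k * Real.exp (-(4 * Real.log n)) ≤ (c ^ 3)⁻¹ := by
  have hn : 0 < n := hc.trans_le hcn
  have h1 : Real.exp (-(4 * Real.log n)) = (n ^ 4)⁻¹ := by
    rw [Real.exp_neg, show (4 : ℝ) * Real.log n = ((4 : ℕ) : ℝ) * Real.log n by norm_num,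
      Real.exp_nat_mul, Real.exp_log hn]
  rw [h1]
  calc (k : ℝ) * (n ^ 4)⁻¹ ≤ n * (n ^ 4)⁻¹ :=
        mul_le_mul_of_nonneg_right hk (by positivity)
    _ = (n ^ 3)⁻¹ := by field_simp
    _ ≤ (c ^ 3)⁻¹ := inv_anti₀ (by positivity) (pow_le_pow_left₀ hc.le hcn 3)

theorem exp_lower_tail_le : Real.exp (Real.exp (-1) - 2 / 3) ≤ 39 / 50 := by
  have h1 := Real.exp_neg_one_lt_d9
  rw [← neg_sub, Real.exp_neg]
  refine (inv_anti₀ (by norm_num) (?_ : (50 / 39 : ℝ) ≤ _)).trans (by norm_num)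
  have h2 := Real.add_one_le_exp (2 / 3 - Real.exp (-1))
  norm_num at h1
  linarith

theorem card_nodeRes_le : S.nodeRes.card ≤ Fintype.card V * Fintype.card T := by
  have : S.nodeRes ⊆ (Finset.univ : Finset (T × V)).image Sum.inl := by
    intro x hx
    obtain ⟨τ, u, -, rfl⟩ := (Finset.mem_filter.1 hx).2
    exact Finset.mem_image_of_mem _ (Finset.mem_univ _)
  refine (Finset.card_le_card this).trans (Finset.card_image_le.trans_eq ?_)
  rw [Finset.card_univ, Fintype.card_prod, mul_comm]

theorem card_edgeRes_le : S.edgeRes.card ≤ S.E.card := by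
  have : S.edgeRes ⊆ S.E.image Sum.inr := by
    intro x hx
    obtain ⟨f, hf, rfl⟩ := (Finset.mem_filter.1 hx).2
    exact Finset.mem_image_of_mem _ hf
  exact (Finset.card_le_card this).trans Finset.card_image_le

/-- A rounding try fails with probability at most `19 / 20`: the tail bounds for the profit, the
node loads and the edge loads add up to at most `39 / 50 + 1 / 27 + 1 / 8`. -/
theorem roundOnce_fail (hV : 3 ≤ Fintype.card V) (hE : S.E.card ≠ 1)
    (hc : ∀ r, IsCactus (Q r).E) {o : ∀ r, Reorientation (Q r).E} {v : ∀ r, LPVars (W r) V T}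
    (hv : IsLPOptimal Q o (kept Q o) (fun r => (Q r).profit) v) {D : ∀ r, ConvexComb (Q r)}
    (hD : ∀ r ∈ kept Q o, IsDecomposition (v r) (D r)) :
    ∑ s with ¬ IsApprox (∑ r ∈ kept Q o, (Q r).profit * (v r).x) (1 / 3) (beta Q (kept Q o))
      (gamma Q (kept Q o)) s, (roundOnce (kept Q o) D s).toReal ≤ 19 / 20 := by
  set A := kept Q o
  set B := ∑ r ∈ A, (Q r).profit * (v r).x with hB
  have hprofit := (roundOnce_profit hD hB.symm fun r hr => profit_le_of_mem_kept hc hv hr).trans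
    exp_lower_tail_le
  have hnode : ∑ s with ∃ ρ ∈ S.nodeRes, beta Q A * S.cap ρ < load s ρ,
      (roundOnce A D s).toReal ≤ 1 / 27 := by
    by_cases hne : S.nodeRes.Nonempty
    swap
    · rw [Finset.not_nonempty_iff_eq_empty.1 hne]
      norm_num
    have hT : 1 ≤ Fintype.card T := by
      obtain ⟨ρ, hρ⟩ := hne
      obtain ⟨τ, -⟩ := (Finset.mem_filter.1 hρ).2
      exact Fintype.card_pos_iff.2 ⟨τ⟩
    have hn : (3 : ℝ) ≤ Fintype.card V * Fintype.card T := by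
      exact_mod_cast hV.trans (Nat.le_mul_of_pos_right _ hT)
    refine (roundOnce_overload hv.1 hD Finset.subset_union_left fun _ => ?_).trans
      ((card_mul_exp_le ?_ three_pos hn).trans (by norm_num))
    · linarith
    · exact_mod_cast card_nodeRes_le (S := S)
  have hedge : ∑ s with ∃ ρ ∈ S.edgeRes, gamma Q A * S.cap ρ < load s ρ,
      (roundOnce A D s).toReal ≤ 1 / 8 := by
    by_cases hne : S.edgeRes.Nonempty
    swap
    · rw [Finset.not_nonempty_iff_eq_empty.1 hne]
      norm_num
    have hE0 : 0 < S.E.card := (Finset.card_pos.2 hne).trans_le card_edgeRes_le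
    have hn : (2 : ℝ) ≤ S.E.card := by
      exact_mod_cast (show 2 ≤ S.E.card by omega)
    refine (roundOnce_overload hv.1 hD Finset.subset_union_right fun _ => ?_).trans
      ((card_mul_exp_le ?_ two_pos hn).trans (by norm_num))
    · linarith
    · exact_mod_cast card_edgeRes_le (S := S)
  have hsplit : ∑ s with ¬ IsApprox B (1 / 3) (beta Q A) (gamma Q A) s,
      (roundOnce A D s).toReal ≤ ∑ s with profit s < 1 / 3 * B, (roundOnce A D s).toReal +
        ∑ s with ∃ ρ ∈ S.nodeRes, beta Q A * S.cap ρ < load s ρ, (roundOnce A D s).toReal +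
        ∑ s with ∃ ρ ∈ S.edgeRes, gamma Q A * S.cap ρ < load s ρ, (roundOnce A D s).toReal := by
    simp only [Finset.sum_filter, ← Finset.sum_add_distrib]
    refine Finset.sum_le_sum fun s _ => ?_
    have h0 : 0 ≤ (roundOnce A D s).toReal := ENNReal.toReal_nonneg
    have hite : ∀ (p : Prop) [Decidable p], 0 ≤ if p then (roundOnce A D s).toReal else 0 := by
      intro p _
      split_ifs
      exacts [h0, le_rfl]
    have hle : ∀ (p : Prop) [Decidable p],
        (if p then (roundOnce A D s).toReal else 0) ≤ (roundOnce A D s).toReal := by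
      intro p _
      split_ifs
      exacts [le_rfl, h0]
    by_cases h1 : profit s < 1 / 3 * B
    · rw [if_pos h1]
      exact (hle _).trans (le_add_of_le_of_nonneg (le_add_of_nonneg_right (hite _)) (hite _))
    by_cases h2 : ∃ ρ ∈ S.nodeRes, beta Q A * S.cap ρ < load s ρ
    · rw [if_pos h2]
      exact (hle _).trans (le_add_of_le_of_nonneg (le_add_of_nonneg_left (hite _)) (hite _))
    by_cases h3 : ∃ ρ ∈ S.edgeRes, gamma Q A * S.cap ρ < load s ρ
    · rw [if_pos h3]
      exact (hle _).trans (le_add_of_nonneg_left (add_nonneg (hite _) (hite _)))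
    · push Not at h1 h2 h3
      rw [if_neg (not_not.2 ⟨h1, h2, h3⟩)]
      exact add_nonneg (add_nonneg (hite _) (hite _)) (hite _)
  linarith

end Success

end VNEP

end

theorem mainTheorem1 {V T R : Type*} [Fintype V] [Fintype T] [Fintype R]
    {W : R → Type*} [∀ r, Fintype (W r)]
    (S : VNEP.Substrate V T) (Q : ∀ r, VNEP.Request S (W r))
    (hcactus : ∀ r, VNEP.IsCactus (Q r).E)
    (hV : 3 ≤ Fintype.card V) (hE : S.E.card ≠ 1) :
    (∀ r, Nonempty (VNEP.Reorientation (Q r).E)) ∧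
    ∀ o : ∀ r, VNEP.Reorientation (Q r).E,
      -- the LPs of the preprocessing and of the main step have optimal solutions
      (∀ r, ∃ v, VNEP.IsLPOptimal Q o {r} (fun _ => 1) v) ∧
      (∃ v, VNEP.IsLPOptimal Q o (VNEP.kept Q o) (fun r => (Q r).profit) v) ∧
      ∀ v, VNEP.IsLPOptimal Q o (VNEP.kept Q o) (fun r => (Q r).profit) v →
        -- each optimal solution can be decomposed
        (∀ r ∈ VNEP.kept Q o, ∃ D : VNEP.ConvexComb (Q r), VNEP.IsDecomposition (v r) D) ∧
        ∀ D : ∀ r, VNEP.ConvexComb (Q r),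
          (∀ r ∈ VNEP.kept Q o, VNEP.IsDecomposition (v r) (D r)) →
          let A := VNEP.kept Q o
          let β := VNEP.beta Q A
          let γ := VNEP.gamma Q A
          let lpProfit := ∑ r ∈ A, (Q r).profit * (v r).x
          let good : VNEP.Solution Q → Prop := VNEP.IsApprox lpProfit (1 / 3) β γ
          let approx : Set (VNEP.Solution Q) :=
            {s | good s ∧ VNEP.IsApprox (VNEP.optProfit Q) (1 / 3) β γ s}
          -- each single try succeeds with probability at least `1 / 20`
          1 / 20 ≤ (VNEP.roundOnce A D).toOuterMeasure approx ∧
          -- success probability of the algorithm with at most `N + 1` tries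
          ∀ N : ℕ, ENNReal.ofReal (1 - (19 / 20) ^ (N + 1)) ≤
            (VNEP.roundLoop (VNEP.roundOnce A D) good N).toOuterMeasure approx := by
  refine ⟨fun r => (hcactus r).nonempty_reorientation, fun o =>
    ⟨fun r => VNEP.exists_isLPOptimal hcactus o _ _, VNEP.exists_isLPOptimal hcactus o _ _,
      fun v hv => ⟨fun r hr => (hv.1.1 r hr).exists_isDecomposition (hcactus r),
        fun D hD => ?_⟩⟩⟩
  intro A β γ lpProfit good approx
  have hopt : VNEP.optProfit Q ≤ lpProfit := VNEP.optProfit_le hcactus hv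
  -- approximation with respect to the LP profit is the stronger property
  have happrox : approx = {s | good s} := by
    ext s
    refine ⟨fun h => h.1, fun h => ⟨h, le_trans ?_ h.1, h.2⟩⟩
    exact mul_le_mul_of_nonneg_left hopt (by norm_num)
  have hfail : ∑ s with ¬ good s, (VNEP.roundOnce A D s).toReal ≤ 19 / 20 :=
    VNEP.roundOnce_fail hV hE hcactus hv hD
  rw [happrox]
  constructor
  · have h : ENNReal.ofReal (1 / 20) = 1 / 20 := by
      rw [ENNReal.ofReal_div_of_pos (by norm_num)]
      simp
    rw [← h]
    refine VNEP.ofReal_le_toOuterMeasure _ ?_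
    refine le_trans (le_of_eq ?_) (hfail.trans (by norm_num : (19 / 20 : ℝ) ≤ 1 - 1 / 20))
    rfl
  · intro N
    refine VNEP.ofReal_le_toOuterMeasure _ ?_
    rw [sub_sub_cancel]
    refine le_trans (le_of_eq ?_) (pow_le_pow_left₀ (Finset.sum_nonneg fun s _ =>
      ENNReal.toReal_nonneg) hfail (N + 1))
    exact VNEP.roundLoop_fail _ good N
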